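/- **Theorem 2.2.** Let $\mathcal C$ be a braided monoidal category with braiding $\Psi$ in which every object $X$ has a dual $X^*$, with $\mathrm{ev}:X^*\otimes X\to\underline 1$ and $\mathrm{coev}:\underline 1\to X\otimes X^*$ (associativity isomorphisms are suppressed below). A *braided group* is a Hopf algebra in a braided category. *Representability.* For a functor $F:\mathcal D\to\mathcal C$, an object $A$ and a natural family $\beta_X:F(X)\to F(X)\otimes A$, say that $(A,\beta)$ represents $F$ if for all $n\ge 1$ and all objects $V$ of $\mathcal C$ the map $$\theta_n:\mathrm{Mor}(A^{\otimes n},V)\to \mathrm{Nat}(F^{n},F^{n}\otimes V),\qquad F^n(X_1,\dots,X_n)=F(X_1)\otimes\cdots\otimes F(X_n),$$ is a bijection; here $\theta_n(\phi)$ applies $\beta_{X_1}\otimes\cdots\otimes\beta_{X_n}$, moves the copies of $A$ to the right past the $F(X_i)$ with $\Psi$, and applies $\phi$. *Braided reconstruction.* Let $\mathcal D$ be monoidal, $F$ monoidal, and $(A,\beta)$ represent $F$. A Hopf algebra structure on $A$ is *reconstructed from $F$* if (identifying $F(X\otimes Y)$ with $F(X)\otimes F(Y)$ and $F(\underline 1)$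 with $\underline 1$), for all $X,Y$: - $(\mathrm{id}\otimes\Delta)\beta_X=(\beta_X\otimes\mathrm{id})\beta_X$ and $(\mathrm{id}\otimes\epsilon)\beta_X=\mathrm{id}$; - $\beta_{X\otimes Y}=(\mathrm{id}\otimes\mathrm{id}\otimes\cdot)(\mathrm{id}\otimes\Psi_{A,F(Y)}\otimes\mathrm{id})(\beta_X\otimes\beta_Y)$ and $\beta_{\underline 1}=\eta$; - whenever $X$ has a dual $X^*$ in $\mathcal D$, $(\mathrm{id}\otimes S)\beta_X=(\mathrm{id}\otimes\mathrm{ev}\otimes\mathrm{id})(\mathrm{id}\otimes\mathrm{id}\otimes\Psi_{A,F(X)})(\mathrm{id}\otimes\beta_{X^*}\otimes\mathrm{id})(\mathrm{coev}\otimes\mathrm{id})$. Suppose that $(A,\beta)$ represents the identity functor of $\mathcal C$. Then $A$ has exactly one Hopf algebra structure reconstructed from $\mathrm{id}_{\mathcal C}$; with it, $A$ is denoted $\mathrm{Aut}(\mathcal C)$, and $\beta_X:X\to X\otimes \mathrm{Aut}(\mathcal C)$ is the tautological coaction. Let $B$ be a braided group in $\mathcal C$, let $\mathcal C^B$ be the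 monoidal category of right $B$-comodules in $\mathcal C$ (the coaction on a tensor product is the braided one, given by $\Psi$ and the product of $B$), and let $F:\mathcal C^B\to\mathcal C$ be the forgetful functor. Then: 1. $\beta_B:B\to B\otimes\mathrm{Aut}(\mathcal C)$ makes $B$ a right $\mathrm{Aut}(\mathcal C)$-comodule coalgebra, i.e. $\beta_B$ is a coaction and $\Delta_B$, $\epsilon_B$ are comodule morphisms. 2. With the family $(\beta_X\otimes\mathrm{id}_B)\circ\rho:X\to X\otimes(\mathrm{Aut}(\mathcal C)\otimes B)$, for $(X,\rho)\in\mathcal C^B$, the object $\mathrm{Aut}(\mathcal C)\otimes B$ represents $F$, and it has exactly one Hopf algebra structure reconstructed from $F$: the prebosonisation $\mathrm{Aut}(\mathcal C){\blacktriangleright\!\!<}B$. 3. The algebra of this braided group is the braided tensor product algebra: its unit is $\eta_A\otimes\eta_B$ and its product is $(\cdot_A\otimes\cdot_B)(\mathrm{id}_A\otimes\Psi_{B,A}\otimes\mathrm{id}_B)$, where $A=\mathrm{Aut}(\mathcal C)$. 4. Its coalgebra is the cross coproduct by $\beta_B$: its counit is $\epsilon_A\otimes\epsilon_B$ and its coproduct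 is $$(\mathrm{id}_A\otimes\mathrm{id}_B\otimes\cdot_A\otimes\mathrm{id}_B)(\mathrm{id}_A\otimes\Psi_{A,B}\otimes\mathrm{id}_A\otimes\mathrm{id}_B)(\mathrm{id}_A\otimes\mathrm{id}_A\otimes\beta_B\otimes\mathrm{id}_B)(\Delta_A\otimes\Delta_B).$$ -/

import Mathlib

open CategoryTheory MonoidalCategory

universe v u v₁ u₁

namespace BraidedReconstruction

section TensorCoaction

variable {C : Type u} [Category.{v} C] [MonoidalCategory C] [BraidedCategory C]

theorem tensorμ_outer (W Z : C) {X X' Y Y' : C} (f : X ⟶ X') (g : Y ⟶ Y') :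
    (f ▷ W ⊗ₘ g ▷ Z) ≫ tensorμ X' W Y' Z = tensorμ X W Y Z ≫ (f ⊗ₘ g) ▷ (W ⊗ Z) := by
  simpa using tensorμ_natural f (𝟙 W) g (𝟙 Z)

theorem tensorμ_inner (X Y : C) {W W' Z Z' : C} (f : W ⟶ W') (g : Z ⟶ Z') :
    (X ◁ f ⊗ₘ Y ◁ g) ≫ tensorμ X W' Y Z' = tensorμ X W Y Z ≫ (X ⊗ Y) ◁ (f ⊗ₘ g) := by
  simpa using tensorμ_natural (𝟙 X) f (𝟙 Y) g

theorem tensorμ_pair {W Z X X' Y Y' : C} {ρ : X ⟶ X ⊗ W} {ρ' : X' ⟶ X' ⊗ W} {σ : Y ⟶ Y ⊗ Z}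
    {σ' : Y' ⟶ Y' ⊗ Z} {f : X ⟶ X'} {g : Y ⟶ Y'} (hf : f ≫ ρ' = ρ ≫ f ▷ W)
    (hg : g ≫ σ' = σ ≫ g ▷ Z) :
    (f ⊗ₘ g) ≫ (ρ' ⊗ₘ σ') ≫ tensorμ X' W Y' Z =
      ((ρ ⊗ₘ σ) ≫ tensorμ X W Y Z) ≫ (f ⊗ₘ g) ▷ (W ⊗ Z) := by
  rw [tensorHom_comp_tensorHom_assoc, hf, hg, Category.assoc, ← tensorμ_outer,
    tensorHom_comp_tensorHom_assoc]

/-- The braided tensor product of two coactions of a monoid `B`: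
`X ⊗ Y ⟶ (X ⊗ B) ⊗ (Y ⊗ B) ⟶ (X ⊗ Y) ⊗ (B ⊗ B) ⟶ (X ⊗ Y) ⊗ B`, where the second map
crosses `B` over `Y` with the braiding and the third one is the product of `B`. -/
def tensorCoact {B : C} [MonObj B] {X Y : C} (ρ : X ⟶ X ⊗ B) (σ : Y ⟶ Y ⊗ B) :
    X ⊗ Y ⟶ (X ⊗ Y) ⊗ B :=
  (ρ ⊗ₘ σ) ≫ tensorμ X B Y B ≫ (X ⊗ Y) ◁ MonObj.mul

/-- The trivial coaction on the unit object, by the unit of `B`. -/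
def unitCoact (B : C) [MonObj B] : 𝟙_ C ⟶ 𝟙_ C ⊗ B := MonObj.one ≫ (λ_ B).inv

theorem tensorCoact_counit {B : C} [BimonObj B] {X Y : C} (ρ : X ⟶ X ⊗ B) (σ : Y ⟶ Y ⊗ B)
    (hρ : ρ ≫ X ◁ ComonObj.counit = (ρ_ X).inv) (hσ : σ ≫ Y ◁ ComonObj.counit = (ρ_ Y).inv) :
    tensorCoact ρ σ ≫ (X ⊗ Y) ◁ ComonObj.counit = (ρ_ (X ⊗ Y)).inv := by
  rw [tensorCoact, Category.assoc, Category.assoc, ← whiskerLeft_comp, BimonObj.mul_counit]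
  change _ ≫ _ ≫ _ ◁ ((ComonObj.counit ⊗ₘ ComonObj.counit) ≫ (λ_ (𝟙_ C)).hom) = _
  rw [whiskerLeft_comp, ← reassoc_of% tensorμ_inner, tensorHom_comp_tensorHom_assoc,
    hρ, hσ, ← cancel_mono (ρ_ (X ⊗ Y)).hom, Category.assoc,
    Category.assoc, ← rightUnitor_monoidal, tensorHom_comp_tensorHom]
  simp

theorem tensorCoact_comul {B : C} [BimonObj B] {X Y : C} (ρ : X ⟶ X ⊗ B) (σ : Y ⟶ Y ⊗ B)
    (hρ : ρ ≫ X ◁ ComonObj.comul = ρ ≫ ρ ▷ B ≫ (α_ X B B).hom)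
    (hσ : σ ≫ Y ◁ ComonObj.comul = σ ≫ σ ▷ B ≫ (α_ Y B B).hom) :
    tensorCoact ρ σ ≫ (X ⊗ Y) ◁ ComonObj.comul =
      tensorCoact ρ σ ≫ tensorCoact ρ σ ▷ B ≫ (α_ (X ⊗ Y) B B).hom := by
  simp only [tensorCoact, Category.assoc, ← whiskerLeft_comp, BimonObj.mul_comul]
  simp only [whiskerLeft_comp, comp_whiskerRight, Category.assoc]
  rw [← reassoc_of% tensorμ_inner, tensorHom_comp_tensorHom_assoc, hρ, hσ,
    ← tensorHom_comp_tensorHom_assoc, ← tensorHom_comp_tensorHom_assoc,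
    ← associator_monoidal_assoc, reassoc_of% tensorμ_outer]
  rw [whisker_exchange_assoc, whisker_exchange_assoc, associator_naturality_middle,
    tensorHom_def' (MonObj.mul (X := B)), whiskerLeft_comp,
    associator_naturality_right_assoc]

theorem unitCoact_counit (B : C) [BimonObj B] :
    unitCoact B ≫ 𝟙_ C ◁ ComonObj.counit = (ρ_ (𝟙_ C)).inv := by
  rw [unitCoact, Category.assoc, ← leftUnitor_inv_naturality, BimonObj.one_counit_assoc,
    unitors_inv_equal]

theorem unitCoact_comul (B : C) [BimonObj B] :
    unitCoact B ≫ 𝟙_ C ◁ ComonObj.comul =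
      unitCoact B ≫ unitCoact B ▷ B ≫ (α_ (𝟙_ C) B B).hom := by
  rw [unitCoact, Category.assoc, ← leftUnitor_inv_naturality, BimonObj.one_comul_assoc]
  change ((λ_ (𝟙_ C)).inv ≫ (MonObj.one ⊗ₘ MonObj.one)) ≫ _ = _
  simp only [tensorHom_def', Category.assoc, comp_whiskerRight, leftUnitor_inv_whiskerRight,
    Iso.inv_hom_id, Category.comp_id]
  rw [← leftUnitor_inv_naturality_assoc]

theorem tensorCoact_natural {B : C} [MonObj B] {X X' Y Y' : C} {ρ : X ⟶ X ⊗ B}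
    {ρ' : X' ⟶ X' ⊗ B} {σ : Y ⟶ Y ⊗ B} {σ' : Y' ⟶ Y' ⊗ B} (f : X ⟶ X') (g : Y ⟶ Y')
    (hf : ρ ≫ f ▷ B = f ≫ ρ') (hg : σ ≫ g ▷ B = g ≫ σ') :
    tensorCoact ρ σ ≫ (f ⊗ₘ g) ▷ B = (f ⊗ₘ g) ≫ tensorCoact ρ' σ' := by
  simp only [tensorCoact, Category.assoc]
  rw [whisker_exchange, ← reassoc_of% tensorμ_outer, tensorHom_comp_tensorHom_assoc,
    tensorHom_comp_tensorHom_assoc, hf, hg]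

theorem tensorCoact_associator {B : C} [MonObj B] {X Y Z : C} (ρ : X ⟶ X ⊗ B)
    (σ : Y ⟶ Y ⊗ B) (τ : Z ⟶ Z ⊗ B) :
    tensorCoact (tensorCoact ρ σ) τ ≫ (α_ X Y Z).hom ▷ B =
      (α_ X Y Z).hom ≫ tensorCoact ρ (tensorCoact σ τ) := by
  have e₁ : ((ρ ⊗ₘ σ) ≫ tensorμ X B Y B ≫ (X ⊗ Y) ◁ MonObj.mul) ⊗ₘ τ =
      ((ρ ⊗ₘ σ) ⊗ₘ τ) ≫ tensorμ X B Y B ▷ (Z ⊗ B) ≫ ((X ⊗ Y) ◁ MonObj.mul ⊗ₘ 𝟙 (Z ⊗ B)) := by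
    rw [← tensorHom_id, tensorHom_comp_tensorHom, tensorHom_comp_tensorHom]
    simp only [Category.comp_id]
  have e₂ : ρ ⊗ₘ ((σ ⊗ₘ τ) ≫ tensorμ Y B Z B ≫ (Y ⊗ Z) ◁ MonObj.mul) =
      (ρ ⊗ₘ (σ ⊗ₘ τ)) ≫ (X ⊗ B) ◁ tensorμ Y B Z B ≫ (𝟙 (X ⊗ B) ⊗ₘ (Y ⊗ Z) ◁ MonObj.mul) := by
    rw [← id_tensorHom (X ⊗ B) (tensorμ Y B Z B), tensorHom_comp_tensorHom,
      tensorHom_comp_tensorHom]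
    simp only [Category.comp_id]
  have h₁ := tensorμ_inner (X ⊗ Y) Z (MonObj.mul (X := B)) (𝟙 B)
  have h₂ := tensorμ_inner X (Y ⊗ Z) (𝟙 B) (MonObj.mul (X := B))
  rw [whiskerLeft_id] at h₁ h₂
  have h₃ := tensor_associativity X B Y B Z B
  simp only [tensorCoact, e₁, e₂, Category.assoc]
  rw [reassoc_of% h₁, reassoc_of% h₂, ← associator_naturality_assoc, ← reassoc_of% h₃]
  congr 3
  rw [tensorHom_id, id_tensorHom, ← whiskerLeft_comp_assoc, MonObj.mul_assoc,
    MonoidalCategory.tensorHom_def']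
  simp only [whiskerLeft_comp, Category.assoc, whisker_exchange, whisker_exchange_assoc]

theorem tensorCoact_leftUnitor {B : C} [MonObj B] {X : C} (ρ : X ⟶ X ⊗ B) :
    tensorCoact (unitCoact B) ρ ≫ (λ_ X).hom ▷ B = (λ_ X).hom ≫ ρ := by
  have h := tensorμ_inner (𝟙_ C) X (MonObj.one (X := B)) (𝟙 B)
  rw [whiskerLeft_id] at h
  have h₁ : unitCoact B ⊗ₘ ρ = (𝟙_ C ◁ ρ) ≫ ((λ_ (𝟙_ C)).inv ▷ (X ⊗ B)) ≫
      (𝟙_ C ◁ MonObj.one ⊗ₘ 𝟙 (X ⊗ B)) := by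
    rw [tensorHom_id, MonoidalCategory.tensorHom_def', ← comp_whiskerRight, unitCoact,
      leftUnitor_inv_naturality]
  simp only [tensorCoact, h₁, Category.assoc]
  rw [reassoc_of% h, ← whiskerLeft_comp_assoc, tensorHom_id, MonObj.one_mul, whisker_exchange,
    ← MonoidalCategory.tensorHom_def, ← tensor_left_unitality, leftUnitor_naturality]

theorem tensorCoact_rightUnitor {B : C} [MonObj B] {X : C} (ρ : X ⟶ X ⊗ B) :
    tensorCoact ρ (unitCoact B) ≫ (ρ_ X).hom ▷ B = (ρ_ X).hom ≫ ρ := by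
  have h := tensorμ_inner X (𝟙_ C) (𝟙 B) (MonObj.one (X := B))
  rw [whiskerLeft_id] at h
  have h₁ : ρ ⊗ₘ unitCoact B = (ρ ▷ 𝟙_ C) ≫ ((X ⊗ B) ◁ (λ_ (𝟙_ C)).inv) ≫
      (𝟙 (X ⊗ B) ⊗ₘ 𝟙_ C ◁ MonObj.one) := by
    rw [id_tensorHom, MonoidalCategory.tensorHom_def, ← whiskerLeft_comp, unitCoact,
      leftUnitor_inv_naturality]
  simp only [tensorCoact, h₁, Category.assoc]
  rw [reassoc_of% h, ← whiskerLeft_comp_assoc, id_tensorHom, MonObj.mul_one,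
    ← MonoidalCategory.tensorHom_def', ← tensor_right_unitality, rightUnitor_naturality]

end TensorCoaction

section Comodules

variable {C : Type u} [Category.{v} C] [MonoidalCategory C]

/-- A right comodule of a comonoid object `B`: an object `X` with a coaction
`X ⟶ X ⊗ B` that is counital and coassociative. -/
structure Comodule (B : C) [ComonObj B] where
  X : C
  coact : X ⟶ X ⊗ B
  coact_counit : coact ≫ X ◁ ComonObj.counit = (ρ_ X).inv
  coact_comul : coact ≫ X ◁ ComonObj.comul = coact ≫ coact ▷ B ≫ (α_ X B B).hom

namespace Comodule

/-- Morphisms of comodules: morphisms of `C` that intertwine the coactions. -/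
@[ext]
structure Hom {B : C} [ComonObj B] (M N : Comodule B) where
  hom : M.X ⟶ N.X
  comm : M.coact ≫ hom ▷ B = hom ≫ N.coact

variable {B : C}

/-- The category of right `B`-comodules in `C`. -/
instance [ComonObj B] : Category (Comodule B) where
  Hom M N := Hom M N
  id M := { hom := 𝟙 M.X, comm := by simp }
  comp f g :=
    { hom := f.hom ≫ g.hom
      comm := by
        rw [comp_whiskerRight, reassoc_of% f.comm, g.comm, Category.assoc] }

@[simp]
theorem id_hom [ComonObj B] (M : Comodule B) : Hom.hom (𝟙 M) = 𝟙 M.X := rfl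

@[simp]
theorem comp_hom [ComonObj B] {M N P : Comodule B} (f : M ⟶ N) (g : N ⟶ P) :
    Hom.hom (f ≫ g) = f.hom ≫ g.hom := rfl

theorem hom_ext [ComonObj B] {M N : Comodule B} {f g : M ⟶ N} (h : f.hom = g.hom) : f = g :=
  Hom.ext h

/-- The forgetful functor from `B`-comodules to `C`. -/
def forget (B : C) [ComonObj B] : Comodule B ⥤ C where
  obj M := M.X
  map f := f.hom

instance [ComonObj B] : (forget B).Faithful where
  map_injective h := hom_ext h

/-- An isomorphism of the underlying objects that intertwines the coactions. -/
def mkIso [ComonObj B] {M N : Comodule B} (e : M.X ≅ N.X)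
    (h : M.coact ≫ e.hom ▷ B = e.hom ≫ N.coact) : M ≅ N where
  hom := { hom := e.hom, comm := h }
  inv :=
    { hom := e.inv
      comm := by
        rw [← cancel_epi e.hom, ← reassoc_of% h]
        simp }
  hom_inv_id := hom_ext e.hom_inv_id
  inv_hom_id := hom_ext e.inv_hom_id

section Tensor

variable [BraidedCategory C] [BimonObj B]

/-- Comodules of a bimonoid are closed under the tensor product of `C`, with the braided tensor
product coaction, and the unit object carries the trivial coaction. -/
instance : MonoidalCategoryStruct (Comodule B) where
  tensorObj M N :=
    { X := M.X ⊗ N.X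
      coact := tensorCoact M.coact N.coact
      coact_counit := tensorCoact_counit _ _ M.coact_counit N.coact_counit
      coact_comul := tensorCoact_comul _ _ M.coact_comul N.coact_comul }
  tensorUnit :=
    { X := 𝟙_ C
      coact := unitCoact B
      coact_counit := unitCoact_counit B
      coact_comul := unitCoact_comul B }
  tensorHom f g := { hom := f.hom ⊗ₘ g.hom, comm := tensorCoact_natural _ _ f.comm g.comm }
  whiskerLeft M _ _ f :=
    { hom := M.X ◁ f.hom
      comm := by simpa using tensorCoact_natural (𝟙 M.X) f.hom (by simp) f.comm }
  whiskerRight f N :=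
    { hom := f.hom ▷ N.X
      comm := by simpa using tensorCoact_natural f.hom (𝟙 N.X) f.comm (by simp) }
  associator M N P := mkIso (α_ M.X N.X P.X) (tensorCoact_associator _ _ _)
  leftUnitor M := mkIso (λ_ M.X) (tensorCoact_leftUnitor _)
  rightUnitor M := mkIso (ρ_ M.X) (tensorCoact_rightUnitor _)

/-- The category of right comodules of a bimonoid in a braided category is monoidal. -/
instance : MonoidalCategory (Comodule B) where
  tensorHom_def f g := hom_ext (MonoidalCategory.tensorHom_def f.hom g.hom)
  id_tensorHom_id M N := hom_ext (MonoidalCategory.id_tensorHom_id M.X N.X)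
  tensorHom_comp_tensorHom f₁ f₂ g₁ g₂ :=
    hom_ext (MonoidalCategory.tensorHom_comp_tensorHom f₁.hom f₂.hom g₁.hom g₂.hom)
  whiskerLeft_id M N := hom_ext (MonoidalCategory.whiskerLeft_id M.X N.X)
  id_whiskerRight M N := hom_ext (MonoidalCategory.id_whiskerRight M.X N.X)
  associator_naturality f₁ f₂ f₃ :=
    hom_ext (MonoidalCategory.associator_naturality f₁.hom f₂.hom f₃.hom)
  leftUnitor_naturality f := hom_ext (MonoidalCategory.leftUnitor_naturality f.hom)
  rightUnitor_naturality f := hom_ext (MonoidalCategory.rightUnitor_naturality f.hom)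
  pentagon M N P Q := hom_ext (MonoidalCategory.pentagon M.X N.X P.X Q.X)
  triangle M N := hom_ext (MonoidalCategory.triangle M.X N.X)

/-- The forgetful functor is monoidal, with identity comparison morphisms. -/
def forgetCoreMonoidal (B : C) [BimonObj B] : (forget B).CoreMonoidal where
  εIso := Iso.refl (𝟙_ C)
  μIso M N := Iso.refl (M.X ⊗ N.X)
  μIso_hom_natural_left f N := by
    change f.hom ▷ N.X ≫ 𝟙 (_ ⊗ _) = 𝟙 (_ ⊗ _) ≫ f.hom ▷ N.X
    rw [Category.id_comp, Category.comp_id]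
  μIso_hom_natural_right M f := by
    change M.X ◁ f.hom ≫ 𝟙 (_ ⊗ _) = 𝟙 (_ ⊗ _) ≫ M.X ◁ f.hom
    rw [Category.id_comp, Category.comp_id]
  associativity M N P := by
    change 𝟙 (M.X ⊗ N.X) ▷ P.X ≫ 𝟙 ((M.X ⊗ N.X) ⊗ P.X) ≫ (α_ M.X N.X P.X).hom =
      (α_ M.X N.X P.X).hom ≫ M.X ◁ 𝟙 (N.X ⊗ P.X) ≫ 𝟙 (M.X ⊗ N.X ⊗ P.X)
    simp
  left_unitality M := by
    change (λ_ M.X).hom = 𝟙 (𝟙_ C) ▷ M.X ≫ 𝟙 (𝟙_ C ⊗ M.X) ≫ (λ_ M.X).hom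
    simp
  right_unitality M := by
    change (ρ_ M.X).hom = M.X ◁ 𝟙 (𝟙_ C) ≫ 𝟙 (M.X ⊗ 𝟙_ C) ≫ (ρ_ M.X).hom
    simp

instance (B : C) [BimonObj B] : (forget B).Monoidal := (forgetCoreMonoidal B).toMonoidal

end Tensor

end Comodule

end Comodules

section Reconstruction

variable {C : Type u} [Category.{v} C] [MonoidalCategory C]
variable {D : Type u₁} [Category.{v₁} D]

/-- `NatTensor F V` is the collection `Nat(F, F ⊗ V)` of natural transformations with components
`F X ⟶ F X ⊗ V`. -/
@[ext]
structure NatTensor (F : D ⥤ C) (V : C) where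
  app : ∀ X : D, F.obj X ⟶ F.obj X ⊗ V
  naturality : ∀ {X Y : D} (f : X ⟶ Y), F.map f ≫ app Y = app X ≫ F.map f ▷ V

/-- Composition of a transformation in `Nat(F, F ⊗ V)` with a morphism `V ⟶ W`. -/
def NatTensor.postcomp {F : D ⥤ C} {V W : C} (τ : NatTensor F V) (φ : V ⟶ W) :
    NatTensor F W where
  app X := τ.app X ≫ F.obj X ◁ φ
  naturality f := by
    rw [reassoc_of% τ.naturality f, Category.assoc, whisker_exchange]

/-- The functor `F ⊗ ⋯ ⊗ F` with `n + 1` factors, from `D × ⋯ × D` to `C`, bracketed to the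
right. -/
def powFunctor (F : D ⥤ C) : (n : ℕ) → (Fin (n + 1) → D) ⥤ C
  | 0 =>
    { obj := fun X => F.obj (X 0)
      map := fun f => F.map (f 0) }
  | n + 1 =>
    { obj := fun X => F.obj (X 0) ⊗ (powFunctor F n).obj (fun i => X i.succ)
      map := fun f => F.map (f 0) ⊗ₘ (powFunctor F n).map (fun i => f i.succ)
      map_id := fun X => by
        have h := (powFunctor F n).map_id (fun i => X i.succ)
        change F.map (𝟙 (X 0)) ⊗ₘ (powFunctor F n).map (𝟙 _) = _
        rw [h, F.map_id, id_tensorHom_id]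
      map_comp := fun f g => by
        have h := (powFunctor F n).map_comp (fun i => f i.succ) (fun i => g i.succ)
        change F.map (f 0 ≫ g 0) ⊗ₘ (powFunctor F n).map ((fun i => f i.succ) ≫ _) = _
        rw [h, F.map_comp, tensorHom_comp_tensorHom] }

/-- The object `A ⊗ ⋯ ⊗ A` with `n + 1` factors, bracketed to the right. -/
def powObj (A : C) : ℕ → C
  | 0 => A
  | n + 1 => A ⊗ powObj A n

variable [BraidedCategory C]

/-- The transformation in `Nat(F ⊗ ⋯ ⊗ F, (F ⊗ ⋯ ⊗ F) ⊗ (A ⊗ ⋯ ⊗ A))` with `n + 1` factors that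
`β` in `Nat(F, F ⊗ A)` induces: apply `β` to every factor and move the copies of `A` to the right
with the braiding. -/
def NatTensor.pow {F : D ⥤ C} {A : C} (β : NatTensor F A) :
    (n : ℕ) → NatTensor (powFunctor F n) (powObj A n)
  | 0 =>
    { app := fun X => β.app (X 0)
      naturality := fun f => β.naturality (f 0) }
  | n + 1 =>
    { app := fun X => (β.app (X 0) ⊗ₘ (β.pow n).app (fun i => X i.succ)) ≫
        tensorμ (F.obj (X 0)) A ((powFunctor F n).obj (fun i => X i.succ)) (powObj A n)
      naturality := fun f => tensorμ_pair (β.naturality (f 0)) ((β.pow n).naturality (fun i => f i.succ)) }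

/-- `A` with `β` represents `V ↦ Nat(F, F ⊗ V)`, together with all its higher order versions: for
every number `n + 1` of factors and every `V`, the map
`θ : Mor(A ⊗ ⋯ ⊗ A, V) ⟶ Nat(F ⊗ ⋯ ⊗ F, (F ⊗ ⋯ ⊗ F) ⊗ V)` that `β` induces is a bijection. -/
def Represents (F : D ⥤ C) (A : C) (β : NatTensor F A) : Prop :=
  ∀ (n : ℕ) (V : C),
    Function.Bijective (fun φ : powObj A n ⟶ V => (β.pow n).postcomp φ)

variable [MonoidalCategory D]

open Functor.LaxMonoidal Functor.OplaxMonoidal in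
/-- The Hopf monoid `A` with the coactions `β` is the braided reconstruction from the monoidal
functor `F`. The pair `(A, β)` represents `Nat(F, F ⊗ -)`, so that each structure morphism of `A`
is determined by its image under the bijections `θ`: -/
structure IsBraidedReconstruction (F : D ⥤ C) [F.Monoidal] (A : C) [HopfObj A]
    (β : NatTensor F A) : Prop where
  represents : Represents F A β
  /-- the coproduct and the counit make every `β_X` a coaction; -/
  comul : ∀ X : D, β.app X ≫ F.obj X ◁ ComonObj.comul =
    β.app X ≫ β.app X ▷ A ≫ (α_ (F.obj X) A A).hom
  counit : ∀ X : D, β.app X ≫ F.obj X ◁ ComonObj.counit = (ρ_ (F.obj X)).inv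
  /-- the product and the unit correspond to `β` on tensor products and on the unit object, where
  `F (X ⊗ Y)` is identified with `F X ⊗ F Y` and `F 1` with `1`; -/
  mul : ∀ X Y : D, μ F X Y ≫ β.app (X ⊗ Y) ≫ δ F X Y ▷ A = tensorCoact (β.app X) (β.app Y)
  one : ε F ≫ β.app (𝟙_ D) ≫ η F ▷ A = unitCoact A
  /-- the antipode corresponds to `β` on duals: for `Y` dual to `X`, it is the composite
  `X ⟶ X ⊗ (Y ⊗ X) ⟶ X ⊗ ((Y ⊗ A) ⊗ X) ⟶ X ⊗ ((Y ⊗ X) ⊗ A) ⟶ X ⊗ A` of the coevaluation, `β_Y`,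
  the braiding of `A` with `X` and the evaluation (with `F` omitted). -/
  antipode : ∀ (X Y : D) [ExactPairing X Y],
    β.app X ≫ F.obj X ◁ HopfObj.antipode =
      (λ_ (F.obj X)).inv ≫ (ε F ≫ F.map (ExactPairing.coevaluation X Y) ≫ δ F X Y) ▷ F.obj X ≫
        (α_ (F.obj X) (F.obj Y) (F.obj X)).hom ≫
        F.obj X ◁ (β.app Y ▷ F.obj X ≫ (α_ (F.obj Y) A (F.obj X)).hom ≫
          F.obj Y ◁ (β_ A (F.obj X)).hom ≫ (α_ (F.obj Y) (F.obj X) A).inv ≫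
          (μ F Y X ≫ F.map (ExactPairing.evaluation X Y) ≫ η F) ▷ A ≫ (λ_ A).hom)

/-- For `β` in `Nat(id, id ⊗ A)` and a comonoid `B`, the transformation in `Nat(F, F ⊗ (A ⊗ B))`
on the forgetful functor `F` of `B`-comodules: apply the coaction of `B` and then `β`. -/
def comoduleCoaction {A : C} (β : NatTensor (𝟭 C) A) (B : C) [ComonObj B] :
    NatTensor (Comodule.forget B) (A ⊗ B) where
  app M := M.coact ≫ β.app M.X ▷ B ≫ (α_ M.X A B).hom
  naturality := fun {M N} f => by
    have h : M.coact ≫ f.hom ▷ B = f.hom ≫ N.coact := f.comm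
    have h' : f.hom ≫ β.app N.X = β.app M.X ≫ f.hom ▷ A := β.naturality f.hom
    change f.hom ≫ N.coact ≫ β.app N.X ▷ B ≫ (α_ N.X A B).hom =
      (M.coact ≫ β.app M.X ▷ B ≫ (α_ M.X A B).hom) ≫ f.hom ▷ (A ⊗ B)
    rw [← reassoc_of% h, ← comp_whiskerRight_assoc, h', comp_whiskerRight_assoc,
      associator_naturality_left, Category.assoc, Category.assoc]

/-- A right coaction `ρ` of the bimonoid `A` on the comonoid `B` makes `B` a braided comodule
coalgebra: `ρ` is a coaction, and the coproduct and the counit of `B` are comodule morphisms. -/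
structure IsComoduleCoalgebra (A B : C) [BimonObj A] [ComonObj B] (ρ : B ⟶ B ⊗ A) : Prop where
  coact_counit : ρ ≫ B ◁ ComonObj.counit = (ρ_ B).inv
  coact_comul : ρ ≫ B ◁ ComonObj.comul = ρ ≫ ρ ▷ A ≫ (α_ B A A).hom
  comul_hom : ρ ≫ ComonObj.comul ▷ A = ComonObj.comul ≫ tensorCoact ρ ρ
  counit_hom : ρ ≫ ComonObj.counit ▷ A = ComonObj.counit ≫ unitCoact A

/-- The cross coproduct on `A ⊗ B` by a coaction `ρ : B ⟶ B ⊗ A`, the composite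
`A ⊗ B ⟶ (A ⊗ A) ⊗ (B ⊗ B) ⟶ (A ⊗ A) ⊗ ((B ⊗ A) ⊗ B) ⟶ (A ⊗ B) ⊗ ((A ⊗ A) ⊗ B) ⟶
(A ⊗ B) ⊗ (A ⊗ B)` of the two coproducts, `ρ` on the first copy of `B`, the braiding of the second copy of `A` with
`B`, and the product of `A`. -/
def crossComul {A B : C} [MonObj A] [ComonObj A] [ComonObj B] (ρ : B ⟶ B ⊗ A) :
    A ⊗ B ⟶ (A ⊗ B) ⊗ (A ⊗ B) :=
  (ComonObj.comul ⊗ₘ ComonObj.comul) ≫ (A ⊗ A) ◁ (ρ ▷ B ≫ (α_ B A B).hom) ≫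
    tensorμ A A B (A ⊗ B) ≫ (A ⊗ B) ◁ ((α_ A A B).inv ≫ MonObj.mul ▷ B)

end Reconstruction

end BraidedReconstruction

open BraidedReconstruction

/-!
By representability, a morphism from `A`, `A ⊗ A` or `A ⊗ A ⊗ A` is determined by its image under
`θ`, a natural transformation, and every natural transformation of the right shape arises. Hence the
structure morphisms of `A` are defined by the transformations that the reconstruction conditions
prescribe, the axioms become identities between transformations, which hold by naturality of `β`,
and uniqueness is immediate (`Represents.exists_bimonObj`, `IsBraidedReconstruction.unique`).

The antipode is treated through convolution `convComp`, the Kleisli composition of maps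
`X ⟶ X ⊗ A`. A convolution inverse of every `β_X` is automatically natural, so it comes from a map
`S : A ⟶ A`, which is an antipode (`exists_hopfObj_of_convInverse`). If `X` has a dual, then the
transformation in the antipode condition is such an inverse, because `β` is natural with respect to
the evaluation and the coevaluation (`convComp_dualCoact`, `dualCoact_convComp`). As inverses are
unique, the antipode condition holds for any Hopf structure that satisfies the other conditions
(`isBraidedReconstruction_of_bialgebra`).

For the forgetful functor of `B`-comodules, a transformation is determined by its values on the
cofree comodules `X ⊗ B`, where it is a natural family `X ⊗ B ⟶ X ⊗ V`, and by the dual of `B` this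
is a map `A ⊗ B ⟶ V` (`RepresentsFirstOrder.comodule`). Representability of higher order follows
from that of first order, since `C` has duals (`Represents.of_firstOrder`). So `A ⊗ B` is a reconstructed
bimonoid, and its product, coproduct and counit are identified by checking that the proposed
formulas satisfy the reconstruction conditions: coacting with `B` and then with `A` is compatible
with the braided tensor product algebra (`tensorCoactBy_tensor`) and with the cross coproduct
(`comp_crossComul`). The antipode is obtained without constructing duals of comodules: with the
braided tensor product algebra the composite coaction is the convolution product of those
of `A` and `B`, and each of them is inverted by an antipode (`exists_convInverse_tensor`).
-/

namespace BraidedReconstruction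

/-! ### Convolution of coactions -/

section Convolution

variable {C : Type u} [Category.{v} C] [MonoidalCategory C]

section

variable {A : C} [MonObj A]

/-- The convolution product of `X ⟶ Y ⊗ A` and `Y ⟶ Z ⊗ A` for a monoid `A`: the Kleisli
composition of the monad `- ⊗ A`. The factors of `A` are multiplied with the one produced last on
the left. -/
def convComp {X Y Z : C} (f : X ⟶ Y ⊗ A) (g : Y ⟶ Z ⊗ A) : X ⟶ Z ⊗ A :=
  f ≫ g ▷ A ≫ (α_ Z A A).hom ≫ Z ◁ MonObj.mul

/-- The unit of the convolution product `convComp`. -/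
def convUnit (A : C) [MonObj A] (X : C) : X ⟶ X ⊗ A := (ρ_ X).inv ≫ X ◁ MonObj.one

theorem convComp_assoc {X Y Z W : C} (f : X ⟶ Y ⊗ A) (g : Y ⟶ Z ⊗ A) (h : Z ⟶ W ⊗ A) :
    convComp (convComp f g) h = convComp f (convComp g h) := by
  have e : Z ◁ MonObj.mul ≫ h ▷ A ≫ (α_ W A A).hom ≫ W ◁ MonObj.mul =
      h ▷ (A ⊗ A) ≫ (α_ W A (A ⊗ A)).hom ≫ W ◁ A ◁ MonObj.mul ≫ W ◁ MonObj.mul := by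
    rw [whisker_exchange_assoc, associator_naturality_right_assoc]
  simp only [convComp, Category.assoc, e, comp_whiskerRight]
  rw [← whiskerLeft_comp W (A ◁ _), MonObj.mul_assoc_flip]
  monoidal

@[simp]
theorem convComp_convUnit {X Y : C} (f : X ⟶ Y ⊗ A) : convComp f (convUnit A Y) = f := by
  have e : (Y ◁ MonObj.one) ▷ A ≫ (α_ Y A A).hom ≫ Y ◁ MonObj.mul =
      (α_ Y (𝟙_ C) A).hom ≫ Y ◁ (λ_ A).hom := by
    rw [associator_naturality_middle_assoc, ← whiskerLeft_comp, MonObj.one_mul]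
  simp only [convComp, convUnit, comp_whiskerRight, Category.assoc, e]
  simp

@[simp]
theorem convUnit_convComp {X Y : C} (f : X ⟶ Y ⊗ A) : convComp (convUnit A X) f = f := by
  simp only [convComp, convUnit, Category.assoc]
  rw [whisker_exchange_assoc, associator_naturality_right_assoc, ← whiskerLeft_comp,
    MonObj.mul_one]
  simp

/-- A left inverse and a right inverse for the convolution product agree. -/
theorem convComp_inv_unique {X : C} {f g h : X ⟶ X ⊗ A} (hl : convComp f g = convUnit A X)
    (hr : convComp g h = convUnit A X) : f = h := by
  rw [← convComp_convUnit f, ← hr, ← convComp_assoc, hl, convUnit_convComp]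

/-- Convolution inverses of intertwined maps are intertwined. -/
theorem convComp_inv_natural {X Y : C} {f t : X ⟶ X ⊗ A} {f' t' : Y ⟶ Y ⊗ A} {h : X ⟶ Y}
    (hl : convComp t f = convUnit A X) (hr : convComp f' t' = convUnit A Y)
    (hf : h ≫ f' = f ≫ h ▷ A) : h ≫ t' = t ≫ h ▷ A := by
  have e : convComp (t ≫ h ▷ A) f' = h ≫ convUnit A Y := by
    calc
      _ = convComp t (h ≫ f') := by simp [convComp]
      _ = convComp t f ≫ h ▷ A := by
        rw [hf]
        simp only [convComp, comp_whiskerRight, Category.assoc]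
        rw [whisker_exchange, associator_naturality_left_assoc]
      _ = _ := by
        rw [hl, convUnit, convUnit, Category.assoc, whisker_exchange]
        simp
  rw [← convComp_convUnit (t ≫ h ▷ A), ← hr, ← convComp_assoc, e]
  calc
    _ = h ≫ convComp (convUnit A Y) t' := by rw [convUnit_convComp]
    _ = _ := by simp [convComp]

/-- Convolution is compatible with monoid morphisms in the second tensor factor. -/
theorem convComp_whiskerLeft {P : C} [MonObj P] (j : A ⟶ P)
    (hj : MonObj.mul ≫ j = (j ⊗ₘ j) ≫ MonObj.mul) {X Y Z : C}
    (f : X ⟶ Y ⊗ A) (g : Y ⟶ Z ⊗ A) :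
    convComp (f ≫ Y ◁ j) (g ≫ Z ◁ j) = convComp f g ≫ Z ◁ j := by
  simp only [convComp, Category.assoc, comp_whiskerRight]
  rw [← whiskerLeft_comp, hj, MonoidalCategory.tensorHom_def', whisker_exchange_assoc]
  monoidal

theorem convUnit_whiskerLeft {P : C} [MonObj P] (j : A ⟶ P)
    (hj : MonObj.one ≫ j = MonObj.one) (X : C) :
    convUnit A X ≫ X ◁ j = convUnit P X := by
  rw [convUnit, Category.assoc, ← whiskerLeft_comp, hj, convUnit]

end

/-- Convolution of maps `X ⟶ X ⊗ A` that factor through a coaction is convolution of endomorphisms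
of `A`, with the order reversed. -/
theorem convComp_of_comul {A : C} [MonObj A] [ComonObj A] {X : C} {ρ : X ⟶ X ⊗ A}
    (hc : ρ ≫ X ◁ ComonObj.comul = ρ ≫ ρ ▷ A ≫ (α_ X A A).hom) (f g : A ⟶ A) :
    convComp (ρ ≫ X ◁ f) (ρ ≫ X ◁ g) = ρ ≫ X ◁ (ComonObj.comul ≫ (g ⊗ₘ f) ≫ MonObj.mul) := by
  simp only [convComp, comp_whiskerRight, Category.assoc, whiskerLeft_comp]
  rw [reassoc_of% hc, MonoidalCategory.tensorHom_def', whiskerLeft_comp, whisker_exchange_assoc]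
  monoidal

end Convolution

/-! ### Convolution inverses from antipodes and from duals -/

section Duality

variable {C : Type u} [Category.{v} C] [MonoidalCategory C] [BraidedCategory C]

section

variable {A : C} [HopfObj A] {X : C} {ρ : X ⟶ X ⊗ A}

theorem convComp_antipode (hc : ρ ≫ X ◁ ComonObj.comul = ρ ≫ ρ ▷ A ≫ (α_ X A A).hom)
    (he : ρ ≫ X ◁ ComonObj.counit = (ρ_ X).inv) :
    convComp ρ (ρ ≫ X ◁ HopfObj.antipode) = convUnit A X := by
  have h := convComp_of_comul hc (𝟙 A) HopfObj.antipode
  rw [whiskerLeft_id, Category.comp_id, tensorHom_id, HopfObj.antipode_left] at h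
  rw [h, whiskerLeft_comp, reassoc_of% he, convUnit]

theorem antipode_convComp (hc : ρ ≫ X ◁ ComonObj.comul = ρ ≫ ρ ▷ A ≫ (α_ X A A).hom)
    (he : ρ ≫ X ◁ ComonObj.counit = (ρ_ X).inv) :
    convComp (ρ ≫ X ◁ HopfObj.antipode) ρ = convUnit A X := by
  have h := convComp_of_comul hc HopfObj.antipode (𝟙 A)
  rw [whiskerLeft_id, Category.comp_id, id_tensorHom, HopfObj.antipode_right] at h
  rw [h, whiskerLeft_comp, reassoc_of% he, convUnit]

end

/-- The transformation `X ⟶ X ⊗ (Y ⊗ X) ⟶ X ⊗ ((Y ⊗ A) ⊗ X) ⟶ X ⊗ ((Y ⊗ X) ⊗ A) ⟶ X ⊗ A` made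
from `c : 𝟙 ⟶ X ⊗ Y`, `e : Y ⊗ X ⟶ 𝟙` and `σ : Y ⟶ Y ⊗ A`, with the braiding of `A` with `X`.
It is the right-hand side of the antipode condition of `IsBraidedReconstruction` when `c` and `e`
are the coevaluation and the evaluation of a duality between `X` and `Y` and `σ` is `β_Y`. -/
def dualCoact {A X Y : C} (c : 𝟙_ C ⟶ X ⊗ Y) (e : Y ⊗ X ⟶ 𝟙_ C) (σ : Y ⟶ Y ⊗ A) : X ⟶ X ⊗ A :=
  (λ_ X).inv ≫ c ▷ X ≫ (α_ X Y X).hom ≫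
    X ◁ (σ ▷ X ≫ (α_ Y A X).hom ≫ Y ◁ (β_ A X).hom ≫ (α_ Y X A).inv ≫ e ▷ A ≫ (λ_ A).hom)

/-- If the evaluation is a comodule morphism, then `dualCoact` is a right convolution inverse. -/
theorem convComp_dualCoact {A X Y : C} [MonObj A] {c : 𝟙_ C ⟶ X ⊗ Y} {e : Y ⊗ X ⟶ 𝟙_ C}
    {ρ : X ⟶ X ⊗ A} {σ : Y ⟶ Y ⊗ A}
    (hz : c ▷ X ≫ (α_ X Y X).hom ≫ X ◁ e = (λ_ X).hom ≫ (ρ_ X).inv)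
    (he : tensorCoact σ ρ ≫ e ▷ A = e ≫ unitCoact A) :
    convComp ρ (dualCoact c e σ) = convUnit A X := by
  have h₁ : Y ◁ ρ ≫ (α_ Y X A).inv ≫ (σ ▷ X ≫ (α_ Y A X).hom ≫ Y ◁ (β_ A X).hom ≫
      (α_ Y X A).inv ≫ e ▷ A ≫ (λ_ A).hom) ▷ A ≫ MonObj.mul = e ≫ MonObj.one := by
    have h := he =≫ (λ_ A).hom
    rw [tensorCoact, tensorμ, MonoidalCategory.tensorHom_def'] at h
    simp only [Category.assoc, whisker_exchange] at h
    rw [unitCoact, Category.assoc, Iso.inv_hom_id, Category.comp_id,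
      ← whisker_exchange_assoc] at h
    rw [← h]
    monoidal
  calc
    _ = (λ_ X).inv ≫ (𝟙_ C ◁ ρ ≫ c ▷ (X ⊗ A)) ⊗≫ X ◁ ((σ ▷ X ≫ (α_ Y A X).hom ≫
          Y ◁ (β_ A X).hom ≫ (α_ Y X A).inv ≫ e ▷ A ≫ (λ_ A).hom) ▷ A ≫ MonObj.mul) := by
      rw [convComp, dualCoact]; monoidal
    _ = (λ_ X).inv ≫ c ▷ X ≫ (α_ X Y X).hom ≫ X ◁ (Y ◁ ρ ≫ (α_ Y X A).inv ≫
          (σ ▷ X ≫ (α_ Y A X).hom ≫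
          Y ◁ (β_ A X).hom ≫ (α_ Y X A).inv ≫ e ▷ A ≫ (λ_ A).hom) ▷ A ≫ MonObj.mul) := by
      rw [whisker_exchange]; monoidal
    _ = _ := by
      rw [h₁, whiskerLeft_comp, reassoc_of% hz, Iso.inv_hom_id_assoc, convUnit]

/-- The braiding of `A` past `Y ⊗ X` is a braiding past `Y` and then past `X`, and the evaluation
`e` removes `Y ⊗ X`. Thus a factor of `A` multiplied from the left after the evaluation may be
crossed over `Y` and multiplied before it. -/
theorem braid_eval_mul {A X Y : C} [MonObj A] (e : Y ⊗ X ⟶ 𝟙_ C) :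
    A ◁ ((α_ Y A X).hom ≫ Y ◁ (β_ A X).hom ≫ (α_ Y X A).inv ≫ e ▷ A ≫ (λ_ A).hom) ≫
        MonObj.mul =
      (α_ A (Y ⊗ A) X).inv ≫ ((α_ A Y A).inv ≫ (β_ A Y).hom ▷ A ≫ (α_ Y A A).hom ≫
        Y ◁ MonObj.mul) ▷ X ≫ (α_ Y A X).hom ≫ Y ◁ (β_ A X).hom ≫ (α_ Y X A).inv ≫
        e ▷ A ≫ (λ_ A).hom := by
  symm
  -- Split the braiding of the product `A ⊗ A ⟶ A` with `X`, so that the left factor of `A` crosses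
  -- all of `Y ⊗ X`; by naturality of the braiding it then passes the evaluation.
  calc
    _ = 𝟙 _ ⊗≫ (β_ A Y).hom ▷ (A ⊗ X) ⊗≫ Y ◁ (MonObj.mul ▷ X ≫ (β_ A X).hom) ⊗≫ e ▷ A ⊗≫ 𝟙 _ := by
      monoidal
    _ = 𝟙 _ ⊗≫ ((β_ A Y).hom ▷ (A ⊗ X) ≫ (Y ⊗ A) ◁ (β_ A X).hom) ⊗≫ Y ◁ (β_ A X).hom ▷ A ⊗≫
          ((Y ⊗ X) ◁ MonObj.mul ≫ e ▷ A) ⊗≫ 𝟙 _ := by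
      rw [BraidedCategory.braiding_naturality_left, BraidedCategory.braiding_tensor_left_hom]
      monoidal
    _ = 𝟙 _ ⊗≫ A ◁ Y ◁ (β_ A X).hom ⊗≫ ((α_ A Y X).inv ≫ (β_ A Y).hom ▷ X ≫ (α_ Y A X).hom ≫
          Y ◁ (β_ A X).hom ≫ (α_ Y X A).inv ≫ e ▷ A) ▷ A ⊗≫ MonObj.mul := by
      rw [← whisker_exchange (β_ A Y).hom (β_ A X).hom, whisker_exchange e]
      monoidal
    _ = 𝟙 _ ⊗≫ A ◁ Y ◁ (β_ A X).hom ⊗≫ (A ◁ e ≫ (ρ_ A).hom ≫ (λ_ A).inv) ▷ A ⊗≫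
          MonObj.mul := by
      have h := BraidedCategory.braiding_naturality_right A e
      rw [BraidedCategory.braiding_tensor_right_hom, braiding_tensorUnit_right] at h
      simp only [Category.assoc] at h
      rw [h]
    _ = _ := by monoidal

/-- If the coevaluation is a comodule morphism, then `dualCoact` is a left convolution inverse. -/
theorem dualCoact_convComp {A X Y : C} [MonObj A] {c : 𝟙_ C ⟶ X ⊗ Y} {e : Y ⊗ X ⟶ 𝟙_ C}
    {ρ : X ⟶ X ⊗ A} {σ : Y ⟶ Y ⊗ A}
    (hz : c ▷ X ≫ (α_ X Y X).hom ≫ X ◁ e = (λ_ X).hom ≫ (ρ_ X).inv)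
    (hc : c ≫ tensorCoact ρ σ = unitCoact A ≫ c ▷ A) :
    convComp (dualCoact c e σ) ρ = convUnit A X := by
  calc
    _ = (λ_ X).inv ⊗≫ c ▷ X ⊗≫ (X ◁ (σ ▷ X ≫ (α_ Y A X).hom ≫ Y ◁ (β_ A X).hom ≫
          (α_ Y X A).inv ≫ e ▷ A ≫ (λ_ A).hom) ≫ ρ ▷ A) ⊗≫ X ◁ MonObj.mul := by
      rw [convComp, dualCoact]; monoidal
    _ = (λ_ X).inv ⊗≫ (c ≫ ρ ▷ Y ≫ (X ⊗ A) ◁ σ) ▷ X ⊗≫ X ◁ (A ◁ ((α_ Y A X).hom ≫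
          Y ◁ (β_ A X).hom ≫ (α_ Y X A).inv ≫ e ▷ A ≫ (λ_ A).hom) ≫ MonObj.mul) := by
      rw [whisker_exchange]; monoidal
    _ = (λ_ X).inv ⊗≫ (c ≫ tensorCoact ρ σ) ▷ X ⊗≫ X ◁ (Y ◁ (β_ A X).hom ≫
          (α_ Y X A).inv ≫ e ▷ A ≫ (λ_ A).hom) := by
      rw [braid_eval_mul, tensorCoact, tensorμ, MonoidalCategory.tensorHom_def]; monoidal
    _ = (λ_ X).inv ⊗≫ (c ▷ X ≫ (α_ X Y X).hom ≫ X ◁ e) ⊗≫ X ◁ MonObj.one := by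
      have h := BraidedCategory.braiding_naturality_left (MonObj.one (X := A)) X
      rw [braiding_tensorUnit_left] at h
      calc
        _ = (λ_ X).inv ⊗≫ (MonObj.one : 𝟙_ C ⟶ A) ▷ X ⊗≫ (c ▷ (A ⊗ X) ≫ (X ⊗ Y) ◁ (β_ A X).hom) ⊗≫
              X ◁ e ▷ A ⊗≫ 𝟙 _ := by
          rw [hc, unitCoact]; monoidal
        _ = (λ_ X).inv ⊗≫ ((MonObj.one : 𝟙_ C ⟶ A) ▷ X ≫ (β_ A X).hom) ⊗≫ c ▷ (X ⊗ A) ⊗≫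
              X ◁ e ▷ A ⊗≫ 𝟙 _ := by
          rw [← whisker_exchange]; monoidal
        _ = (ρ_ X).inv ⊗≫ (𝟙_ C ◁ X ◁ MonObj.one ≫ c ▷ (X ⊗ A)) ⊗≫ X ◁ e ▷ A ⊗≫ 𝟙 _ := by
          rw [h]; monoidal
        _ = (ρ_ X).inv ⊗≫ c ▷ (X ⊗ 𝟙_ C) ⊗≫ X ◁ ((Y ⊗ X) ◁ MonObj.one ≫ e ▷ A) ⊗≫ 𝟙 _ := by
          rw [whisker_exchange]; monoidal
        _ = _ := by
          rw [whisker_exchange]; monoidal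
    _ = _ := by
      rw [hz, convUnit]; monoidal

end Duality

/-! ### Representability of first and of higher order -/

section Representability

variable {C : Type u} [Category.{v} C] [MonoidalCategory C]
variable {D : Type u₁} [Category.{v₁} D]

/-- `(A, β)` represents the functor `V ↦ Nat(F, F ⊗ V)`. -/
def RepresentsFirstOrder (F : D ⥤ C) (A : C) (β : NatTensor F A) : Prop :=
  ∀ V : C, Function.Bijective (fun φ : A ⟶ V => β.postcomp φ)

namespace RepresentsFirstOrder

variable {F : D ⥤ C} {A : C} {β : NatTensor F A}

theorem hom_ext (hβ : RepresentsFirstOrder F A β) {V : C} {φ ψ : A ⟶ V}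
    (h : ∀ X, β.app X ≫ F.obj X ◁ φ = β.app X ≫ F.obj X ◁ ψ) : φ = ψ :=
  (hβ V).injective (NatTensor.ext (funext h))

theorem exists_hom (hβ : RepresentsFirstOrder F A β) {V : C} (τ : NatTensor F V) :
    ∃ φ : A ⟶ V, ∀ X, β.app X ≫ F.obj X ◁ φ = τ.app X := by
  obtain ⟨φ, hφ⟩ := (hβ V).surjective τ
  exact ⟨φ, fun X => congrFun (congrArg NatTensor.app hφ) X⟩

/-- Precomposition with `β` is compatible with the adjunction between `- ⊗ W` and `- ⊗ Wᘁ`, applied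
to `A` on the left-hand side and to `F X` on the right-hand side. -/
theorem app_comp_tensorRightHomEquiv (β : NatTensor F A) {W V : C} [HasRightDual W]
    (χ : A ⊗ W ⟶ V) (X : D) :
    β.app X ≫ F.obj X ◁ tensorRightHomEquiv A W Wᘁ V χ =
      tensorRightHomEquiv (F.obj X) W Wᘁ (F.obj X ⊗ V)
        (β.app X ▷ W ≫ (α_ _ _ _).hom ≫ F.obj X ◁ χ) ≫ (α_ _ _ _).hom := by
  simp only [tensorRightHomEquiv, Equiv.coe_fn_mk]
  calc
    _ = (ρ_ _).inv ≫ (β.app X ▷ 𝟙_ C ≫ (F.obj X ⊗ A) ◁ η_ W Wᘁ) ⊗≫ F.obj X ◁ χ ▷ Wᘁ := by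
      monoidal
    _ = _ := by
      rw [← whisker_exchange]; monoidal

/-- With a dual of `W`, a representing object also represents the natural families
`F X ⊗ W ⟶ F X ⊗ V`: injectivity. -/
theorem hom_ext_right (hβ : RepresentsFirstOrder F A β) {W V : C} [HasRightDual W]
    {φ ψ : A ⊗ W ⟶ V}
    (h : ∀ X, β.app X ▷ W ≫ (α_ _ _ _).hom ≫ F.obj X ◁ φ =
      β.app X ▷ W ≫ (α_ _ _ _).hom ≫ F.obj X ◁ ψ) : φ = ψ := by
  apply (tensorRightHomEquiv A W Wᘁ V).injective
  refine hβ.hom_ext fun X => ?_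
  rw [app_comp_tensorRightHomEquiv, app_comp_tensorRightHomEquiv, h]

/-- With a dual of `W`, a representing object also represents the natural families
`F X ⊗ W ⟶ F X ⊗ V`: surjectivity. -/
theorem exists_hom_right (hβ : RepresentsFirstOrder F A β) {W V : C} [HasRightDual W]
    (σ : ∀ X, F.obj X ⊗ W ⟶ F.obj X ⊗ V)
    (hσ : ∀ {X Y : D} (f : X ⟶ Y), F.map f ▷ W ≫ σ Y = σ X ≫ F.map f ▷ V) :
    ∃ φ : A ⊗ W ⟶ V, ∀ X, β.app X ▷ W ≫ (α_ _ _ _).hom ≫ F.obj X ◁ φ = σ X := by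
  obtain ⟨t, ht⟩ := hβ.exists_hom (V := V ⊗ Wᘁ)
    { app := fun X => tensorRightHomEquiv (F.obj X) W Wᘁ (F.obj X ⊗ V) (σ X) ≫ (α_ _ _ _).hom
      naturality := fun {X Y} f => by
        simp only [tensorRightHomEquiv, Equiv.coe_fn_mk, Category.assoc]
        rw [← associator_naturality_left, ← comp_whiskerRight_assoc, ← hσ,
          rightUnitor_inv_naturality_assoc, ← whisker_exchange_assoc]
        simp }
  refine ⟨(tensorRightHomEquiv A W Wᘁ V).symm t, fun X => ?_⟩
  apply (tensorRightHomEquiv (F.obj X) W Wᘁ (F.obj X ⊗ V)).injective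
  rw [← cancel_mono (α_ _ _ _).hom, ← app_comp_tensorRightHomEquiv, Equiv.apply_symm_apply]
  exact ht X

end RepresentsFirstOrder

variable [BraidedCategory C] {F : D ⥤ C} {A : C} {β : NatTensor F A}

namespace Represents

theorem firstOrder (hβ : Represents F A β) : RepresentsFirstOrder F A β := by
  intro V
  refine ⟨fun φ ψ h => (hβ 0 V).injective (NatTensor.ext (funext fun X => ?_)), fun τ => ?_⟩
  · exact congrFun (congrArg NatTensor.app h) (X 0)
  · obtain ⟨φ, hφ⟩ := (hβ 0 V).surjective
      { app := fun X => τ.app (X 0)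
        naturality := fun f => τ.naturality (f 0) }
    exact ⟨φ, NatTensor.ext (funext fun X => congrFun (congrArg NatTensor.app hφ) (fun _ => X))⟩

theorem hom_ext (hβ : Represents F A β) {V : C} {φ ψ : A ⟶ V}
    (h : ∀ X, β.app X ≫ F.obj X ◁ φ = β.app X ≫ F.obj X ◁ ψ) : φ = ψ :=
  hβ.firstOrder.hom_ext h

theorem exists_hom (hβ : Represents F A β) {V : C} (τ : NatTensor F V) :
    ∃ φ : A ⟶ V, ∀ X, β.app X ≫ F.obj X ◁ φ = τ.app X :=
  hβ.firstOrder.exists_hom τ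

theorem hom_ext₂ (hβ : Represents F A β) {V : C} {φ ψ : A ⊗ A ⟶ V}
    (h : ∀ X Y, (β.app X ⊗ₘ β.app Y) ≫ tensorμ _ A _ A ≫ (F.obj X ⊗ F.obj Y) ◁ φ =
      (β.app X ⊗ₘ β.app Y) ≫ tensorμ _ A _ A ≫ (F.obj X ⊗ F.obj Y) ◁ ψ) : φ = ψ := by
  refine (hβ 1 V).injective (NatTensor.ext (funext fun X => ?_))
  have := h (X 0) (X 1)
  simp only [← Category.assoc] at this
  exact this

theorem hom_ext₃ (hβ : Represents F A β) {V : C} {φ ψ : A ⊗ (A ⊗ A) ⟶ V}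
    (h : ∀ X Y Z, (β.app X ⊗ₘ ((β.app Y ⊗ₘ β.app Z) ≫ tensorμ _ A _ A)) ≫
        tensorμ _ A _ (A ⊗ A) ≫ (F.obj X ⊗ (F.obj Y ⊗ F.obj Z)) ◁ φ =
      (β.app X ⊗ₘ ((β.app Y ⊗ₘ β.app Z) ≫ tensorμ _ A _ A)) ≫
        tensorμ _ A _ (A ⊗ A) ≫ (F.obj X ⊗ (F.obj Y ⊗ F.obj Z)) ◁ ψ) : φ = ψ := by
  refine (hβ 2 V).injective (NatTensor.ext (funext fun X => ?_))
  have := h (X 0) (X 1) (X 2)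
  simp only [← Category.assoc] at this
  exact this

theorem exists_hom₂ (hβ : Represents F A β) {V : C}
    (τ : ∀ X Y, F.obj X ⊗ F.obj Y ⟶ (F.obj X ⊗ F.obj Y) ⊗ V)
    (hτ : ∀ {X X' Y Y' : D} (f : X ⟶ X') (g : Y ⟶ Y'),
      (F.map f ⊗ₘ F.map g) ≫ τ X' Y' = τ X Y ≫ (F.map f ⊗ₘ F.map g) ▷ V) :
    ∃ φ : A ⊗ A ⟶ V, ∀ X Y, (β.app X ⊗ₘ β.app Y) ≫ tensorμ _ A _ A ≫
      (F.obj X ⊗ F.obj Y) ◁ φ = τ X Y := by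
  obtain ⟨φ, hφ⟩ := (hβ 1 V).surjective
    { app := fun X => τ (X 0) (X 1)
      naturality := fun f => hτ (f 0) (f 1) }
  refine ⟨φ, fun X Y => ?_⟩
  have := congrFun (congrArg NatTensor.app hφ) ![X, Y]
  rw [← Category.assoc]
  exact this

/-- Crossing `A` over `G Y` and then applying `γ`, or applying `γ` and then crossing `A` over both
`G Y` and `A'`, give the same result. With it, a family in two variables is handled as a family in
one variable with the parameter object `A`. -/
theorem braiding_pow_app {G : D ⥤ C} {A' : C} (γ : NatTensor G A') {V : C} (χ : A ⊗ A' ⟶ V)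
    (Y : D) :
    (β_ A (G.obj Y)).hom ≫ γ.app Y ▷ A ≫ (α_ _ _ _).hom ≫ G.obj Y ◁ ((β_ A A').inv ≫ χ) =
      A ◁ γ.app Y ≫ (α_ _ _ _).inv ≫ (β_ A (G.obj Y)).hom ▷ A' ≫ (α_ _ _ _).hom ≫
        G.obj Y ◁ χ := by
  rw [← BraidedCategory.braiding_naturality_right_assoc,
    BraidedCategory.braiding_tensor_right_hom]
  simp

/-- Applying `β` and `γ` one after the other to `F X ⊗ G Y` is applying both at once and collecting
the copies of `A` and `A'` on the right, as in the definition of `NatTensor.pow`. -/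
theorem app_whiskerLeft_braiding {G : D ⥤ C} {A' : C} (γ : NatTensor G A') {V : C}
    (χ : A ⊗ A' ⟶ V) {E : Type*} [Category E] {F : E ⥤ C} (β : NatTensor F A) (X : E) (Y : D) :
    β.app X ▷ G.obj Y ≫ (α_ _ _ _).hom ≫ F.obj X ◁ (A ◁ γ.app Y ≫ (α_ _ _ _).inv ≫
        (β_ A (G.obj Y)).hom ▷ A' ≫ (α_ _ _ _).hom ≫ G.obj Y ◁ χ) =
      ((β.app X ⊗ₘ γ.app Y) ≫ tensorμ _ A _ A' ≫ (F.obj X ⊗ G.obj Y) ◁ χ) ≫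
        (α_ _ _ _).hom := by
  rw [tensorμ, MonoidalCategory.tensorHom_def]
  monoidal

/-- Over a category with right duals, a representing object for the natural transformations
`F ⟶ F ⊗ V` also represents the higher order ones. By induction: a family of order `n + 2` that is
natural in `X` and in the remaining variables `Y` is, for fixed `Y`, a map `A ⊗ W ⟶ W ⊗ V`,
where `W` is the value of `powFunctor F n` at `Y`, by first order representability with the
parameter `W`. These maps are natural in `Y`, and therefore come from a map
`A ⊗ powObj A n ⟶ V`, by the induction hypothesis with the parameter `A`. -/
theorem of_firstOrder [RightRigidCategory C] (hβ : RepresentsFirstOrder F A β) :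
    Represents F A β := by
  intro n
  induction n with
  | zero =>
    intro V
    refine ⟨fun φ ψ h => hβ.hom_ext fun X => ?_, fun τ => ?_⟩
    · exact congrFun (congrArg NatTensor.app h) (fun _ => X)
    · obtain ⟨φ, hφ⟩ := hβ.exists_hom (V := V)
        { app := fun X => τ.app (fun _ => X)
          naturality := fun f => τ.naturality (fun _ => f) }
      refine ⟨φ, NatTensor.ext (funext fun X => ?_)⟩
      obtain ⟨X₀, rfl⟩ : ∃ X₀, X = fun _ => X₀ :=
        ⟨X 0, funext fun i => congrArg X (Fin.fin_one_eq_zero i)⟩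
      exact hφ X₀
  | succ n ih =>
    intro V
    have ih' : RepresentsFirstOrder (powFunctor F n) (powObj A n) (β.pow n) := ih
    let : ∀ X : C, HasRightDual X := RightRigidCategory.rightDual
    -- The braiding moves the parameter `A` from the left, where `powObj` puts it, to the right.
    have inj : ∀ φ ψ : A ⊗ powObj A n ⟶ V, (∀ X Y,
        (β.app X ⊗ₘ (β.pow n).app Y) ≫ tensorμ _ A _ (powObj A n) ≫ (_ ⊗ _) ◁ φ =
        (β.app X ⊗ₘ (β.pow n).app Y) ≫ tensorμ _ A _ (powObj A n) ≫ (_ ⊗ _) ◁ ψ) → φ = ψ := by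
      intro φ ψ h
      rw [← cancel_epi (β_ A (powObj A n)).inv]
      refine ih'.hom_ext_right fun Y => ?_
      rw [← cancel_epi (β_ A _).hom, braiding_pow_app, braiding_pow_app]
      refine hβ.hom_ext_right fun X => ?_
      rw [app_whiskerLeft_braiding, app_whiskerLeft_braiding, h]
    refine ⟨fun φ ψ h => inj φ ψ fun X Y => ?_, fun τ => ?_⟩
    · rw [← Category.assoc, ← Category.assoc]
      exact congrFun (congrArg NatTensor.app h) (Fin.cons X Y)
    · let τ' : ∀ (X : D) (Y : Fin (n + 1) → D), F.obj X ⊗ (powFunctor F n).obj Y ⟶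
          (F.obj X ⊗ (powFunctor F n).obj Y) ⊗ V := fun X Y => τ.app (Fin.cons X Y)
      have hτ' : ∀ {X X' : D} {Y Y' : Fin (n + 1) → D} (f : X ⟶ X') (g : Y ⟶ Y'),
          (F.map f ⊗ₘ (powFunctor F n).map g) ≫ τ' X' Y' =
            τ' X Y ≫ (F.map f ⊗ₘ (powFunctor F n).map g) ▷ V := by
        intro X X' Y Y' f g
        let k : (Fin.cons X Y : Fin (n + 2) → D) ⟶ Fin.cons X' Y' :=
          fun i => Fin.cases (motive := fun i => (Fin.cons X Y : Fin (n + 2) → D) i ⟶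
            (Fin.cons X' Y' : Fin (n + 2) → D) i) f g i
        exact τ.naturality k
      -- The variable `X` is eliminated for each `Y`, and `ht'` is the naturality in `Y`.
      choose t ht using fun Y : Fin (n + 1) → D =>
        hβ.exists_hom_right (W := (powFunctor F n).obj Y) (V := (powFunctor F n).obj Y ⊗ V)
          (fun X => τ' X Y ≫ (α_ _ _ _).hom) (fun {X X'} f => by
            have h := hτ' f (𝟙 Y)
            rw [(powFunctor F n).map_id, tensorHom_id] at h
            rw [reassoc_of% h, Category.assoc, associator_naturality_left])
      have ht' : ∀ {Y Y' : Fin (n + 1) → D} (g : Y ⟶ Y'),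
          A ◁ (powFunctor F n).map g ≫ t Y' = t Y ≫ (powFunctor F n).map g ▷ V := by
        intro Y Y' g
        refine hβ.hom_ext_right fun X => ?_
        have h := hτ' (𝟙 X) g
        rw [F.map_id, id_tensorHom] at h
        rw [whiskerLeft_comp, whiskerLeft_comp, reassoc_of% ht, ← associator_naturality_middle,
          ← associator_naturality_right_assoc, ← whisker_exchange_assoc, ht, reassoc_of% h]
      obtain ⟨ψ, hψ⟩ := ih'.exists_hom_right (W := A) (V := V)
        (fun Y => (β_ A _).inv ≫ t Y) (fun {Y Y'} g => by
          rw [BraidedCategory.braiding_inv_naturality_left_assoc, ht', Category.assoc])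
      refine ⟨(β_ A _).hom ≫ ψ, NatTensor.ext (funext fun X => ?_)⟩
      obtain ⟨X, Y, rfl⟩ : ∃ X₀ Y₀, X = Fin.cons X₀ Y₀ :=
        ⟨X 0, fun i => X i.succ, (Fin.cons_self_tail X).symm⟩
      have h := app_whiskerLeft_braiding (β.pow n) ((β_ A _).hom ≫ ψ) β X Y
      rw [← braiding_pow_app, Iso.inv_hom_id_assoc, hψ, Iso.hom_inv_id_assoc, ht,
        cancel_mono, ← Category.assoc] at h
      exact h.symm

end Represents

end Representability

/-! ### Tensor products of coactions for a product without axioms -/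

section RawTensorCoaction

variable {C : Type u} [Category.{v} C] [MonoidalCategory C] [BraidedCategory C] {A : C}

/-- The tensor product `tensorCoact` of two maps `X ⟶ X ⊗ A` and `Y ⟶ Y ⊗ A`, for a product `m`
on `A` that need not satisfy any axiom. -/
def tensorCoactBy (m : A ⊗ A ⟶ A) {X Y : C} (ρ : X ⟶ X ⊗ A) (σ : Y ⟶ Y ⊗ A) :
    X ⊗ Y ⟶ (X ⊗ Y) ⊗ A :=
  (ρ ⊗ₘ σ) ≫ tensorμ X A Y A ≫ (X ⊗ Y) ◁ m

variable (m : A ⊗ A ⟶ A)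

theorem tensorCoactBy_natural {X X' Y Y' : C} {ρ : X ⟶ X ⊗ A} {ρ' : X' ⟶ X' ⊗ A}
    {σ : Y ⟶ Y ⊗ A} {σ' : Y' ⟶ Y' ⊗ A} (f : X ⟶ X') (g : Y ⟶ Y')
    (hf : ρ ≫ f ▷ A = f ≫ ρ') (hg : σ ≫ g ▷ A = g ≫ σ') :
    tensorCoactBy m ρ σ ≫ (f ⊗ₘ g) ▷ A = (f ⊗ₘ g) ≫ tensorCoactBy m ρ' σ' := by
  simp only [tensorCoactBy, Category.assoc]
  rw [whisker_exchange, ← reassoc_of% tensorμ_outer, tensorHom_comp_tensorHom_assoc,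
    tensorHom_comp_tensorHom_assoc, hf, hg]

/-- Coacting on `X ⊗ (Y ⊗ Z)` evaluates the product `a(bc)` on the transformation of order three. -/
theorem tensorCoactBy_right {X Y Z : C} (ρ : X ⟶ X ⊗ A) (σ : Y ⟶ Y ⊗ A) (τ : Z ⟶ Z ⊗ A) :
    (ρ ⊗ₘ ((σ ⊗ₘ τ) ≫ tensorμ Y A Z A)) ≫ tensorμ X A (Y ⊗ Z) (A ⊗ A) ≫
        (X ⊗ Y ⊗ Z) ◁ (A ◁ m ≫ m) =
      tensorCoactBy m ρ (tensorCoactBy m σ τ) := by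
  have h := tensorμ_inner X (Y ⊗ Z) (𝟙 A) m
  rw [whiskerLeft_id, id_tensorHom, id_tensorHom] at h
  rw [whiskerLeft_comp, ← reassoc_of% h]
  simp only [tensorCoactBy]
  rw [← id_tensorHom, tensorHom_comp_tensorHom_assoc]
  simp

/-- Coacting on `(X ⊗ Y) ⊗ Z` evaluates the product `(ab)c` on the transformation of order three. -/
theorem tensorCoactBy_left {X Y Z : C} (ρ : X ⟶ X ⊗ A) (σ : Y ⟶ Y ⊗ A) (τ : Z ⟶ Z ⊗ A) :
    (ρ ⊗ₘ ((σ ⊗ₘ τ) ≫ tensorμ Y A Z A)) ≫ tensorμ X A (Y ⊗ Z) (A ⊗ A) ≫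
        (X ⊗ Y ⊗ Z) ◁ ((α_ A A A).inv ≫ m ▷ A ≫ m) =
      (α_ X Y Z).inv ≫ tensorCoactBy m (tensorCoactBy m ρ σ) τ ≫ (α_ X Y Z).hom ▷ A := by
  have e₁ : ((ρ ⊗ₘ σ) ≫ tensorμ X A Y A ≫ (X ⊗ Y) ◁ m) ⊗ₘ τ =
      ((ρ ⊗ₘ σ) ⊗ₘ τ) ≫ tensorμ X A Y A ▷ (Z ⊗ A) ≫ ((X ⊗ Y) ◁ m ⊗ₘ 𝟙 (Z ⊗ A)) := by
    rw [← tensorHom_id, tensorHom_comp_tensorHom, tensorHom_comp_tensorHom]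
    simp only [Category.comp_id]
  have e₂ : ρ ⊗ₘ ((σ ⊗ₘ τ) ≫ tensorμ Y A Z A) =
      (ρ ⊗ₘ (σ ⊗ₘ τ)) ≫ (X ⊗ A) ◁ tensorμ Y A Z A := by
    rw [← id_tensorHom (X ⊗ A) (tensorμ Y A Z A), tensorHom_comp_tensorHom]
    simp only [Category.comp_id]
  have h₁ := tensorμ_inner (X ⊗ Y) Z m (𝟙 A)
  rw [whiskerLeft_id] at h₁
  have h₃ := tensor_associativity X A Y A Z A
  rw [Iso.eq_inv_comp]
  simp only [tensorCoactBy, e₁, e₂, Category.assoc]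
  rw [reassoc_of% h₁, ← associator_naturality_assoc, ← reassoc_of% h₃]
  congr 3
  rw [tensorHom_id, MonoidalCategory.tensorHom_def']
  simp only [whiskerLeft_comp, Category.assoc, whisker_exchange, whisker_exchange_assoc,
    whiskerLeft_hom_inv_assoc]

theorem tensorCoactBy_one_left (o : 𝟙_ C ⟶ A) {X : C} (ρ : X ⟶ X ⊗ A) :
    tensorCoactBy m (o ≫ (λ_ A).inv) ρ ≫ (λ_ X).hom ▷ A =
      (λ_ X).hom ≫ ρ ≫ X ◁ ((λ_ A).inv ≫ o ▷ A ≫ m) := by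
  have h := tensorμ_inner (𝟙_ C) X o (𝟙 A)
  rw [whiskerLeft_id] at h
  have h₁ : (o ≫ (λ_ A).inv) ⊗ₘ ρ = (𝟙_ C ◁ ρ) ≫ ((λ_ (𝟙_ C)).inv ▷ (X ⊗ A)) ≫
      (𝟙_ C ◁ o ⊗ₘ 𝟙 (X ⊗ A)) := by
    rw [tensorHom_id, MonoidalCategory.tensorHom_def', ← comp_whiskerRight,
      leftUnitor_inv_naturality]
  have h₂ : X ◁ (o ▷ A ≫ m) = X ◁ (λ_ A).hom ≫ X ◁ ((λ_ A).inv ≫ o ▷ A ≫ m) := by simp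
  rw [← cancel_epi (λ_ X).inv, Iso.inv_hom_id_assoc]
  simp only [tensorCoactBy, h₁, Category.assoc]
  rw [reassoc_of% h, tensorHom_id, ← whiskerLeft_comp_assoc, whisker_exchange,
    ← leftUnitor_inv_naturality_assoc, h₂, ← MonoidalCategory.tensorHom_def_assoc,
    ← tensor_left_unitality_assoc, Iso.inv_hom_id_assoc]

theorem tensorCoactBy_one_right (o : 𝟙_ C ⟶ A) {X : C} (ρ : X ⟶ X ⊗ A) :
    tensorCoactBy m ρ (o ≫ (λ_ A).inv) ≫ (ρ_ X).hom ▷ A =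
      (ρ_ X).hom ≫ ρ ≫ X ◁ ((ρ_ A).inv ≫ A ◁ o ≫ m) := by
  have h := tensorμ_inner X (𝟙_ C) (𝟙 A) o
  rw [whiskerLeft_id] at h
  have h₁ : ρ ⊗ₘ (o ≫ (λ_ A).inv) = (ρ ▷ 𝟙_ C) ≫ ((X ⊗ A) ◁ (λ_ (𝟙_ C)).inv) ≫
      (𝟙 (X ⊗ A) ⊗ₘ 𝟙_ C ◁ o) := by
    rw [id_tensorHom, MonoidalCategory.tensorHom_def, ← whiskerLeft_comp,
      leftUnitor_inv_naturality]
  have h₂ : X ◁ (A ◁ o ≫ m) = X ◁ (ρ_ A).hom ≫ X ◁ ((ρ_ A).inv ≫ A ◁ o ≫ m) := by simp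
  rw [← cancel_epi (ρ_ X).inv, Iso.inv_hom_id_assoc]
  simp only [tensorCoactBy, h₁, Category.assoc]
  rw [reassoc_of% h, id_tensorHom, ← whiskerLeft_comp_assoc, whisker_exchange,
    ← rightUnitor_inv_naturality_assoc, h₂, ← MonoidalCategory.tensorHom_def_assoc,
    ← tensor_right_unitality_assoc, Iso.inv_hom_id_assoc]

/-- The tensor coaction applied twice, in terms of the coproduct `(· ⊗ ·) (id ⊗ Ψ ⊗ id) (d ⊗ d)` of
a product. This is what makes a reconstructed coproduct multiplicative. -/
theorem tensorCoact_comp_tensorCoact [MonObj A] {d : A ⟶ A ⊗ A} {X Y : C} {ρ : X ⟶ X ⊗ A}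
    {σ : Y ⟶ Y ⊗ A} (hρ : ρ ≫ X ◁ d = ρ ≫ ρ ▷ A ≫ (α_ X A A).hom)
    (hσ : σ ≫ Y ◁ d = σ ≫ σ ▷ A ≫ (α_ Y A A).hom) :
    (ρ ⊗ₘ σ) ≫ tensorμ X A Y A ≫
        (X ⊗ Y) ◁ ((d ⊗ₘ d) ≫ tensorμ A A A A ≫ (MonObj.mul ⊗ₘ MonObj.mul)) =
      tensorCoact ρ σ ≫ tensorCoact ρ σ ▷ A ≫ (α_ (X ⊗ Y) A A).hom := by
  simp only [tensorCoact, whiskerLeft_comp, comp_whiskerRight, Category.assoc]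
  rw [← reassoc_of% tensorμ_inner, tensorHom_comp_tensorHom_assoc, hρ, hσ,
    ← tensorHom_comp_tensorHom_assoc, ← tensorHom_comp_tensorHom_assoc,
    ← associator_monoidal_assoc, reassoc_of% tensorμ_outer]
  rw [whisker_exchange_assoc, whisker_exchange_assoc, associator_naturality_middle,
    MonoidalCategory.tensorHom_def' (MonObj.mul (X := A)), whiskerLeft_comp,
    associator_naturality_right_assoc]

theorem tensor_counit_coact {d : A ⟶ 𝟙_ C} {X Y : C} {ρ : X ⟶ X ⊗ A} {σ : Y ⟶ Y ⊗ A}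
    (hρ : ρ ≫ X ◁ d = (ρ_ X).inv) (hσ : σ ≫ Y ◁ d = (ρ_ Y).inv) :
    (ρ ⊗ₘ σ) ≫ tensorμ X A Y A ≫ (X ⊗ Y) ◁ ((d ⊗ₘ d) ≫ (λ_ (𝟙_ C)).hom) =
      (ρ_ (X ⊗ Y)).inv := by
  rw [whiskerLeft_comp, ← reassoc_of% tensorμ_inner, tensorHom_comp_tensorHom_assoc,
    hρ, hσ, ← cancel_mono (ρ_ (X ⊗ Y)).hom, Category.assoc,
    Category.assoc, ← rightUnitor_monoidal, tensorHom_comp_tensorHom]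
  simp

end RawTensorCoaction

section

open Functor.LaxMonoidal Functor.OplaxMonoidal

/-- A monoidal functor preserves exact pairings: one of the triangle identities. -/
theorem map_evaluation_coevaluation {C : Type u} [Category.{v} C] [MonoidalCategory C]
    {D : Type u₁} [Category.{v₁} D] [MonoidalCategory D] (F : D ⥤ C) [F.Monoidal]
    (X Y : D) [ExactPairing X Y] :
    (ε F ≫ F.map (ExactPairing.coevaluation X Y) ≫ δ F X Y) ▷ F.obj X ≫
        (α_ (F.obj X) (F.obj Y) (F.obj X)).hom ≫
        F.obj X ◁ (μ F Y X ≫ F.map (ExactPairing.evaluation X Y) ≫ η F) =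
      (λ_ (F.obj X)).hom ≫ (ρ_ (F.obj X)).inv := by
  have h := congrArg F.map (ExactPairing.evaluation_coevaluation X Y)
  simp only [Functor.map_comp, Functor.Monoidal.map_whiskerRight, Functor.Monoidal.map_whiskerLeft,
    Functor.Monoidal.map_associator, Functor.Monoidal.map_leftUnitor,
    Functor.Monoidal.map_rightUnitor_inv, Category.assoc, Functor.Monoidal.μ_δ_assoc,
    cancel_epi] at h
  simp only [← Category.assoc, cancel_mono] at h
  simp only [Category.assoc] at h
  simp only [comp_whiskerRight, whiskerLeft_comp, Category.assoc]
  rw [reassoc_of% h]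
  simp

end

/-! ### Reconstruction of the bialgebra -/

section BialgebraReconstruction

variable {C : Type u} [Category.{v} C] [MonoidalCategory C] [BraidedCategory C]
variable {D : Type u₁} [Category.{v₁} D]

open Functor.LaxMonoidal Functor.OplaxMonoidal

/-- The part of `IsBraidedReconstruction` that concerns the monoid structure. -/
structure IsMonoidReconstruction [MonoidalCategory D] (F : D ⥤ C) [F.Monoidal] (A : C) [MonObj A]
    (β : NatTensor F A) : Prop where
  mul : ∀ X Y : D, μ F X Y ≫ β.app (X ⊗ Y) ≫ δ F X Y ▷ A = tensorCoact (β.app X) (β.app Y)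
  one : ε F ≫ β.app (𝟙_ D) ≫ η F ▷ A = unitCoact A

/-- The part of `IsBraidedReconstruction` that concerns the comonoid structure. -/
structure IsComonoidReconstruction (F : D ⥤ C) (A : C) [ComonObj A]
    (β : NatTensor F A) : Prop where
  comul : ∀ X : D, β.app X ≫ F.obj X ◁ ComonObj.comul =
    β.app X ≫ β.app X ▷ A ≫ (α_ (F.obj X) A A).hom
  counit : ∀ X : D, β.app X ≫ F.obj X ◁ ComonObj.counit = (ρ_ (F.obj X)).inv

variable {F : D ⥤ C} {A : C} {β : NatTensor F A}

namespace Represents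

/-- The coproduct and the counit correspond to the transformations `(β ⊗ id) β` and `id`; the
comonoid axioms hold because both sides have the same image under representability. -/
theorem exists_comonObj (hβ : Represents F A β) :
    ∃ _ : ComonObj A, IsComonoidReconstruction F A β := by
  obtain ⟨d, hd⟩ := hβ.exists_hom (V := A ⊗ A)
    { app := fun X => β.app X ≫ β.app X ▷ A ≫ (α_ (F.obj X) A A).hom
      naturality := fun {X Y} f => by
        rw [reassoc_of% β.naturality f, ← comp_whiskerRight_assoc, β.naturality f,
          comp_whiskerRight_assoc, associator_naturality_left, Category.assoc, Category.assoc] }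
  obtain ⟨e, he⟩ := hβ.exists_hom (V := 𝟙_ C)
    { app := fun X => (ρ_ (F.obj X)).inv
      naturality := fun f => by simp }
  dsimp only at hd he
  let i : ComonObj A :=
    { comul := d, counit := e, counit_comul := ?_, comul_counit := ?_, comul_assoc := ?_ }
  · exact ⟨i, { comul := hd, counit := he }⟩
  · refine hβ.hom_ext fun X => ?_
    rw [whiskerLeft_comp, reassoc_of% hd, ← associator_naturality_middle,
      ← comp_whiskerRight_assoc, he]
    simp
  · refine hβ.hom_ext fun X => ?_
    rw [whiskerLeft_comp, reassoc_of% hd, ← associator_naturality_right,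
      ← whisker_exchange_assoc, reassoc_of% he]
    simp
  · refine hβ.hom_ext fun X => ?_
    simp only [whiskerLeft_comp]
    rw [reassoc_of% hd, reassoc_of% hd, ← associator_naturality_right,
      ← whisker_exchange_assoc, reassoc_of% hd, ← associator_naturality_middle_assoc,
      ← comp_whiskerRight_assoc, hd]
    simp

variable [MonoidalCategory D] [F.Monoidal]

/-- The product corresponds to `β_{X ⊗ Y}`, a transformation of order two, and the unit is `β` on
the unit object. The unit laws and associativity express naturality of `β` with respect to the
unitors and the associator of `D`. -/
theorem exists_monObj (hβ : Represents F A β) :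
    ∃ _ : MonObj A, IsMonoidReconstruction F A β := by
  obtain ⟨m, hm⟩ := hβ.exists_hom₂ (fun X Y => μ F X Y ≫ β.app (X ⊗ Y) ≫ δ F X Y ▷ A)
    (fun f g => by
      rw [μ_natural_assoc, reassoc_of% β.naturality, ← comp_whiskerRight, ← δ_natural]
      simp only [comp_whiskerRight, Category.assoc])
  have hm' : ∀ X Y, tensorCoactBy m (β.app X) (β.app Y) =
    μ F X Y ≫ β.app (X ⊗ Y) ≫ δ F X Y ▷ A := hm
  let o : 𝟙_ C ⟶ A := ε F ≫ β.app (𝟙_ D) ≫ η F ▷ A ≫ (λ_ A).hom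
  have ho : ε F ≫ β.app (𝟙_ D) ≫ η F ▷ A = o ≫ (λ_ A).inv := by simp [o]
  let i : MonObj A := { one := o, mul := m, one_mul := ?_, mul_one := ?_, mul_assoc := ?_ }
  · exact ⟨i, { mul := fun X Y => (hm' X Y).symm, one := ho }⟩
  · rw [← cancel_epi (λ_ A).inv, Iso.inv_hom_id]
    refine hβ.hom_ext fun X => ?_
    have h := tensorCoactBy_natural m (ρ := β.app (𝟙_ D))
      (ρ' := ε F ≫ β.app (𝟙_ D) ≫ η F ▷ A) (η F) (𝟙 (F.obj X)) (by simp)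
      (σ := β.app X) (σ' := β.app X) (by simp)
    have h₂ : F.map (λ_ X).hom ≫ β.app X = β.app _ ≫ F.map (λ_ X).hom ▷ A :=
      β.naturality (λ_ X).hom
    have h₃ : η F ▷ F.obj X ≫ (λ_ (F.obj X)).hom = μ F _ _ ≫ F.map (λ_ X).hom := by
      rw [Functor.LaxMonoidal.left_unitality F, Functor.Monoidal.whiskerRight_η_ε_assoc]
    rw [← cancel_epi (λ_ (F.obj X)).hom, ← tensorCoactBy_one_left, ← ho,
      ← cancel_epi (η F ▷ F.obj X), ← tensorHom_id, ← reassoc_of% h, hm', whiskerLeft_id,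
      Category.comp_id, tensorHom_id, reassoc_of% h₃, h₂, ← left_unitality_hom]
    simp only [comp_whiskerRight, Category.assoc]
  · rw [← cancel_epi (ρ_ A).inv, Iso.inv_hom_id]
    refine hβ.hom_ext fun X => ?_
    have h := tensorCoactBy_natural m (σ := β.app (𝟙_ D))
      (σ' := ε F ≫ β.app (𝟙_ D) ≫ η F ▷ A) (𝟙 (F.obj X)) (η F)
      (ρ := β.app X) (ρ' := β.app X) (by simp) (by simp)
    have h₂ : F.map (ρ_ X).hom ≫ β.app X = β.app _ ≫ F.map (ρ_ X).hom ▷ A :=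
      β.naturality (ρ_ X).hom
    have h₃ : F.obj X ◁ η F ≫ (ρ_ (F.obj X)).hom = μ F _ _ ≫ F.map (ρ_ X).hom := by
      rw [Functor.LaxMonoidal.right_unitality F, Functor.Monoidal.whiskerLeft_η_ε_assoc]
    rw [← cancel_epi (ρ_ (F.obj X)).hom, ← tensorCoactBy_one_right, ← ho,
      ← cancel_epi (F.obj X ◁ η F), ← id_tensorHom, ← reassoc_of% h, hm', whiskerLeft_id,
      Category.comp_id, id_tensorHom, reassoc_of% h₃, h₂, ← right_unitality_hom]
    simp only [comp_whiskerRight, Category.assoc]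
  · -- `powObj A 2` is bracketed to the right, so associativity is compared on `A ⊗ (A ⊗ A)`.
    refine (cancel_epi (α_ A A A).inv).1 ?_
    refine hβ.hom_ext₃ fun X Y Z => ?_
    rw [Iso.inv_hom_id_assoc, tensorCoactBy_left, tensorCoactBy_right, hm', hm']
    have h₁ := tensorCoactBy_natural m (ρ := β.app (X ⊗ Y))
      (ρ' := μ F X Y ≫ β.app (X ⊗ Y) ≫ δ F X Y ▷ A) (δ F X Y) (𝟙 (F.obj Z)) (by simp)
      (σ := β.app Z) (σ' := β.app Z) (by simp)
    have h₂ := tensorCoactBy_natural m (σ := β.app (Y ⊗ Z))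
      (σ' := μ F Y Z ≫ β.app (Y ⊗ Z) ≫ δ F Y Z ▷ A) (𝟙 (F.obj X)) (δ F Y Z)
      (ρ := β.app X) (ρ' := β.app X) (by simp) (by simp)
    have h₃ : F.map (α_ X Y Z).inv ≫ β.app _ = β.app _ ≫ F.map (α_ X Y Z).inv ▷ A :=
      β.naturality (α_ X Y Z).inv
    rw [tensorHom_id, hm', ← cancel_epi (μ F X Y ▷ F.obj Z),
      Functor.Monoidal.whiskerRight_μ_δ_assoc] at h₁
    rw [id_tensorHom, hm', ← cancel_epi (F.obj X ◁ μ F Y Z),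
      Functor.Monoidal.whiskerLeft_μ_δ_assoc] at h₂
    rw [← h₁, ← h₂]
    simp only [Category.assoc]
    rw [← Functor.LaxMonoidal.associativity_inv_assoc, reassoc_of% h₃]
    simp only [← comp_whiskerRight, δ_comp_whiskerLeft_δ]

/-- Multiplicativity of the coproduct and the counit says that the tensor coaction on
`F X ⊗ F Y ≅ F (X ⊗ Y)` is a coaction. -/
theorem exists_bimonObj (hβ : Represents F A β) :
    ∃ _ : BimonObj A, IsMonoidReconstruction F A β ∧ IsComonoidReconstruction F A β := by
  obtain ⟨hm, hm'⟩ := hβ.exists_monObj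
  obtain ⟨hc, hc'⟩ := hβ.exists_comonObj
  have ho : MonObj.one = ε F ≫ β.app (𝟙_ D) ≫ η F ▷ A ≫ (λ_ A).hom := by
    have h := hm'.one =≫ (λ_ A).hom
    simpa [unitCoact] using h.symm
  have hu : ∀ X Y {V : C} (f : (F.obj X ⊗ F.obj Y) ⊗ A ⟶ V),
      (β.app X ⊗ₘ β.app Y) ≫ tensorμ _ A _ A ≫ (F.obj X ⊗ F.obj Y) ◁ MonObj.mul ≫ f =
        μ F X Y ≫ β.app (X ⊗ Y) ≫ δ F X Y ▷ A ≫ f := by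
    intro X Y V f
    have h := hm'.mul X Y =≫ f
    simp only [tensorCoact, Category.assoc] at h
    exact h.symm
  refine ⟨{ hm, hc with mul_comul := ?_, mul_counit := ?_, one_comul := ?_, one_counit := ?_ },
    hm', hc'⟩
  · refine hβ.hom_ext₂ fun X Y => ?_
    rw [tensorCoact_comp_tensorCoact (hc'.comul X) (hc'.comul Y), whiskerLeft_comp, hu,
      ← hm'.mul]
    simp only [Category.assoc, comp_whiskerRight]
    rw [← whisker_exchange, reassoc_of% hc'.comul (X ⊗ Y)]
    simp
  · change _ = (λ_ _).inv ≫ (MonObj.one ⊗ₘ MonObj.one)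
    calc
      _ = (ε F ≫ β.app (𝟙_ D) ≫ η F ▷ A) ≫ (ε F ≫ β.app (𝟙_ D) ≫ η F ▷ A) ▷ A ≫
            (α_ (𝟙_ C) A A).hom ≫ (λ_ (A ⊗ A)).hom := by
        rw [ho]
        simp only [Category.assoc, comp_whiskerRight]
        rw [← leftUnitor_naturality, ← whisker_exchange_assoc, reassoc_of% hc'.comul]
        simp
      _ = _ := by
        rw [hm'.one, unitCoact, MonoidalCategory.tensorHom_def', ← leftUnitor_inv_naturality_assoc]
        monoidal
  · refine hβ.hom_ext₂ fun X Y => ?_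
    refine Eq.trans ?_ (tensor_counit_coact (hc'.counit X) (hc'.counit Y)).symm
    rw [whiskerLeft_comp, hu, ← whisker_exchange, reassoc_of% hc'.counit (X ⊗ Y)]
    simp
  · rw [ho]
    simp only [Category.assoc]
    rw [← leftUnitor_naturality, ← whisker_exchange_assoc, reassoc_of% hc'.counit]
    simp [unitors_equal]

end Represents

/-! ### Uniqueness of the reconstructed structure -/

section Uniqueness

variable {F : D ⥤ C} {A : C} {β : NatTensor F A}

theorem IsComonoidReconstruction.comul_eq {_ : ComonObj A} (h : IsComonoidReconstruction F A β)
    (hβ : Represents F A β) {d : A ⟶ A ⊗ A}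
    (hd : ∀ X, β.app X ≫ F.obj X ◁ d = β.app X ≫ β.app X ▷ A ≫ (α_ (F.obj X) A A).hom) :
    ComonObj.comul = d :=
  hβ.hom_ext fun X => (h.comul X).trans (hd X).symm

theorem IsComonoidReconstruction.counit_eq {_ : ComonObj A} (h : IsComonoidReconstruction F A β)
    (hβ : Represents F A β) {e : A ⟶ 𝟙_ C}
    (he : ∀ X, β.app X ≫ F.obj X ◁ e = (ρ_ (F.obj X)).inv) : ComonObj.counit = e :=
  hβ.hom_ext fun X => (h.counit X).trans (he X).symm

variable [MonoidalCategory D] [F.Monoidal]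

theorem IsMonoidReconstruction.mul_eq {_ : MonObj A} (h : IsMonoidReconstruction F A β)
    (hβ : Represents F A β) {m : A ⊗ A ⟶ A}
    (hm : ∀ X Y, μ F X Y ≫ β.app (X ⊗ Y) ≫ δ F X Y ▷ A =
      tensorCoactBy m (β.app X) (β.app Y)) : MonObj.mul = m :=
  hβ.hom_ext₂ fun X Y => (h.mul X Y).symm.trans (hm X Y)

namespace IsBraidedReconstruction

theorem isMonoidReconstruction {_ : HopfObj A} (h : IsBraidedReconstruction F A β) :
    IsMonoidReconstruction F A β where
  mul := h.mul
  one := h.one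

theorem isComonoidReconstruction {_ : HopfObj A} (h : IsBraidedReconstruction F A β) :
    IsComonoidReconstruction F A β where
  comul := h.comul
  counit := h.counit

end IsBraidedReconstruction

end Uniqueness

section Ext

variable {A : C}

/-- The unit of a monoid object is determined by the product, so it need not be compared. -/
theorem bimonObj_ext {b₁ b₂ : BimonObj A} (hm : b₁.mul = b₂.mul) (hd : b₁.comul = b₂.comul)
    (he : b₁.counit = b₂.counit) : b₁ = b₂ := by
  have h₁ : b₁.toMonObj = b₂.toMonObj := MonObj.ext _ _ hm
  have h₂ : b₁.toComonObj = b₂.toComonObj := by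
    cases hc₁ : b₁.toComonObj
    cases hc₂ : b₂.toComonObj
    rw [hc₁, hc₂] at hd he
    congr
  cases b₁
  cases b₂
  congr

/-- The antipode of a Hopf monoid is determined by the bimonoid structure, because the identity,
as a morphism of bimonoids, intertwines any two antipodes. -/
theorem hopfObj_ext {h₁ h₂ : HopfObj A} (hm : h₁.mul = h₂.mul) (hd : h₁.comul = h₂.comul)
    (he : h₁.counit = h₂.counit) : h₁ = h₂ := by
  have hb : h₁.toBimonObj = h₂.toBimonObj := bimonObj_ext hm hd he
  obtain @⟨b, S₁, l₁, r₁⟩ := h₁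
  obtain @⟨b', S₂, l₂, r₂⟩ := h₂
  dsimp only at hb
  subst hb
  have hid : IsBimonHom (𝟙 A) := {}
  have h := @HopfObj.hom_antipode _ _ _ _ A A ⟨S₁, l₁, r₁⟩ ⟨S₂, l₂, r₂⟩ (𝟙 A) hid
  rw [Category.id_comp, Category.comp_id] at h
  congr 1
  exact h.symm

end Ext

/-- A representing object carries at most one reconstructed Hopf structure. -/
theorem IsBraidedReconstruction.unique [MonoidalCategory D] {F : D ⥤ C} [F.Monoidal] {A : C}
    {β : NatTensor F A} {h₁ h₂ : HopfObj A}
    (H₁ : @IsBraidedReconstruction _ _ _ _ _ _ _ F _ A h₁ β)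
    (H₂ : @IsBraidedReconstruction _ _ _ _ _ _ _ F _ A h₂ β) : h₁ = h₂ := by
  obtain ⟨hβ, d₁, e₁, m₁, o₁, -⟩ := H₁
  obtain ⟨-, d₂, e₂, m₂, o₂, -⟩ := H₂
  exact hopfObj_ext (hβ.hom_ext₂ fun X Y => (m₁ X Y).symm.trans (m₂ X Y))
    (hβ.hom_ext fun X => (d₁ X).trans (d₂ X).symm)
    (hβ.hom_ext fun X => (e₁ X).trans (e₂ X).symm)

/-! ### Reconstruction of the antipode -/

section Antipode

variable [MonoidalCategory D] {F : D ⥤ C} [F.Monoidal] {A : C} {β : NatTensor F A}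

/-- Naturality of `β` with respect to the evaluation in `D`. -/
theorem IsMonoidReconstruction.evaluation [MonObj A] (h : IsMonoidReconstruction F A β)
    (X Y : D) [ExactPairing X Y] :
    tensorCoact (β.app Y) (β.app X) ≫ (μ F Y X ≫ F.map (ExactPairing.evaluation X Y) ≫ η F) ▷ A =
      (μ F Y X ≫ F.map (ExactPairing.evaluation X Y) ≫ η F) ≫ unitCoact A := by
  rw [← h.mul, ← h.one]
  simp only [Category.assoc, comp_whiskerRight, Functor.Monoidal.whiskerRight_δ_μ_assoc,
    Functor.Monoidal.η_ε_assoc]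
  rw [reassoc_of% β.naturality]

/-- Naturality of `β` with respect to the coevaluation in `D`. -/
theorem IsMonoidReconstruction.coevaluation [MonObj A] (h : IsMonoidReconstruction F A β)
    (X Y : D) [ExactPairing X Y] :
    (ε F ≫ F.map (ExactPairing.coevaluation X Y) ≫ δ F X Y) ≫ tensorCoact (β.app X) (β.app Y) =
      unitCoact A ≫ (ε F ≫ F.map (ExactPairing.coevaluation X Y) ≫ δ F X Y) ▷ A := by
  rw [← h.mul, ← h.one]
  simp only [Category.assoc, comp_whiskerRight, Functor.Monoidal.whiskerRight_η_ε_assoc,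
    Functor.Monoidal.δ_μ_assoc]
  rw [reassoc_of% β.naturality]

/-- For a Hopf monoid the antipode condition of `IsBraidedReconstruction` follows from the others:
both of its sides are convolution inverses of `β_X`. -/
theorem isBraidedReconstruction_of_bialgebra [HopfObj A] (hβ : Represents F A β)
    (hm : IsMonoidReconstruction F A β) (hc : IsComonoidReconstruction F A β) :
    IsBraidedReconstruction F A β where
  represents := hβ
  comul := hc.comul
  counit := hc.counit
  mul := hm.mul
  one := hm.one
  antipode X Y _ := convComp_inv_unique (antipode_convComp (hc.comul X) (hc.counit X))
    (convComp_dualCoact (map_evaluation_coevaluation F X Y) (hm.evaluation X Y))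

/-- A reconstructed bimonoid has an antipode as soon as the transformations `β_X` have
convolution inverses: these are then natural, hence given by a map `S : A ⟶ A`, and the antipode
axioms say that the transformation of `S` is inverse to `β`. -/
theorem exists_hopfObj_of_convInverse [b : BimonObj A] (hβ : Represents F A β)
    (hm : IsMonoidReconstruction F A β) (hc : IsComonoidReconstruction F A β)
    (t : ∀ X, F.obj X ⟶ F.obj X ⊗ A) (hl : ∀ X, convComp (t X) (β.app X) = convUnit A (F.obj X))
    (hr : ∀ X, convComp (β.app X) (t X) = convUnit A (F.obj X)) :
    ∃ _ : HopfObj A, IsBraidedReconstruction F A β := by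
  obtain ⟨S, hS⟩ := hβ.exists_hom
    ⟨t, fun {X Y} f => convComp_inv_natural (hl X) (hr Y) (β.naturality f)⟩
  dsimp only at hS
  -- The order reversal in `convComp_of_comul` turns the right inverse law into the left antipode
  -- law, and conversely.
  have hl' : ComonObj.comul ≫ S ▷ A ≫ MonObj.mul = ComonObj.counit ≫ MonObj.one := by
    refine hβ.hom_ext fun X => ?_
    have h := convComp_of_comul (hc.comul X) (𝟙 A) S
    rw [whiskerLeft_id, Category.comp_id, tensorHom_id, hS, hr] at h
    rw [← h, whiskerLeft_comp, reassoc_of% hc.counit, convUnit]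
  have hr' : ComonObj.comul ≫ A ◁ S ≫ MonObj.mul = ComonObj.counit ≫ MonObj.one := by
    refine hβ.hom_ext fun X => ?_
    have h := convComp_of_comul (hc.comul X) S (𝟙 A)
    rw [whiskerLeft_id, Category.comp_id, id_tensorHom, hS, hl] at h
    rw [← h, whiskerLeft_comp, reassoc_of% hc.counit, convUnit]
  let i : HopfObj A := { b with antipode := S, antipode_left := hl', antipode_right := hr' }
  exact ⟨i, isBraidedReconstruction_of_bialgebra hβ hm hc⟩

/-- If all objects of `D` have duals, the convolution inverse of `β_X` is `dualCoact`, the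
transformation that enters the antipode condition. -/
theorem Represents.exists_hopfObj [RightRigidCategory D] (hβ : Represents F A β) :
    ∃ _ : HopfObj A, IsBraidedReconstruction F A β := by
  obtain ⟨_, hm, hc⟩ := hβ.exists_bimonObj
  let : ∀ X : D, HasRightDual X := RightRigidCategory.rightDual
  let t : ∀ X : D, F.obj X ⟶ F.obj X ⊗ A := fun X =>
    dualCoact (ε F ≫ F.map (ExactPairing.coevaluation X Xᘁ) ≫ δ F X Xᘁ)
      (μ F Xᘁ X ≫ F.map (ExactPairing.evaluation X Xᘁ) ≫ η F) (β.app Xᘁ)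
  have hl : ∀ X, convComp (t X) (β.app X) = convUnit A (F.obj X) := fun X =>
    dualCoact_convComp (map_evaluation_coevaluation F X _) (hm.coevaluation X _)
  have hr : ∀ X, convComp (β.app X) (t X) = convUnit A (F.obj X) := fun X =>
    convComp_dualCoact (map_evaluation_coevaluation F X _) (hm.evaluation X _)
  exact exists_hopfObj_of_convInverse hβ hm hc t hl hr

end Antipode

end BialgebraReconstruction

/-! ### Cofree comodules and representability of the forgetful functor -/

section Cofree

variable {C : Type u} [Category.{v} C] [MonoidalCategory C]

namespace Comodule

/-- The cofree comodule `X ⊗ B`, with the coaction given by the coproduct of `B`. -/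
def cofree (B : C) [ComonObj B] (X : C) : Comodule B where
  X := X ⊗ B
  coact := X ◁ ComonObj.comul ≫ (α_ X B B).inv
  coact_counit := by
    rw [Category.assoc, ← associator_inv_naturality_right, ← whiskerLeft_comp_assoc,
      ComonObj.comul_counit]
    simp
  coact_comul := by
    simp only [Category.assoc, comp_whiskerRight]
    rw [← associator_inv_naturality_right, ← whiskerLeft_comp_assoc, ComonObj.comul_assoc]
    monoidal

variable {B : C} [ComonObj B]

/-- The cofree comodule is functorial. -/
def cofreeMap (B : C) [ComonObj B] {X Y : C} (f : X ⟶ Y) : cofree B X ⟶ cofree B Y where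
  hom := f ▷ B
  comm := by
    change (X ◁ _ ≫ _) ≫ f ▷ B ▷ B = f ▷ B ≫ Y ◁ _ ≫ _
    rw [← whisker_exchange_assoc, Category.assoc, associator_inv_naturality_left]

/-- The coaction is a morphism to the cofree comodule on the underlying object. -/
def toCofree (M : Comodule B) : M ⟶ cofree B M.X where
  hom := M.coact
  comm := by
    change M.coact ≫ M.coact ▷ B = M.coact ≫ M.X ◁ _ ≫ _
    rw [reassoc_of% M.coact_comul]
    simp

/-- The morphism `X ⊗ B ⟶ X` given by the counit of `B`. -/
def cofreeCounit (B : C) [ComonObj B] (X : C) : X ⊗ B ⟶ X := X ◁ ComonObj.counit ≫ (ρ_ X).hom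

theorem cofreeCounit_naturality {X Y : C} (f : X ⟶ Y) :
    f ▷ B ≫ cofreeCounit B Y = cofreeCounit B X ≫ f := by
  rw [cofreeCounit, cofreeCounit, ← whisker_exchange_assoc, rightUnitor_naturality,
    Category.assoc]

theorem coact_cofreeCounit (M : Comodule B) : M.coact ≫ cofreeCounit B M.X = 𝟙 M.X := by
  rw [cofreeCounit, reassoc_of% M.coact_counit, Iso.inv_hom_id]

theorem comul_cofreeCounit (X : C) :
    (X ◁ ComonObj.comul ≫ (α_ X B B).inv) ≫ cofreeCounit B X ▷ B = 𝟙 (X ⊗ B) := by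
  rw [cofreeCounit, comp_whiskerRight, Category.assoc, ← associator_inv_naturality_middle_assoc,
    ← whiskerLeft_comp_assoc, ComonObj.counit_comul]
  simp

/-- On a cofree comodule `X ⊗ B`, the coactions of `B` and then of `A` lose nothing under the counit
of the inner `B`: what remains is `b` on `X` with `B` as a parameter. -/
theorem cofree_comp_cofreeCounit {A V X : C} {b : X ⟶ X ⊗ A} {b' : X ⊗ B ⟶ (X ⊗ B) ⊗ A}
    (hn : cofreeCounit B X ≫ b = b' ≫ cofreeCounit B X ▷ A) (χ : A ⊗ B ⟶ V) :
    (((X ◁ ComonObj.comul ≫ (α_ X B B).inv) ≫ b' ▷ B ≫ (α_ (X ⊗ B) A B).hom) ≫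
        (X ⊗ B) ◁ χ) ≫ cofreeCounit B X ▷ V =
      b ▷ B ≫ (α_ X A B).hom ≫ X ◁ χ := by
  have h := comul_cofreeCounit (B := B) X
  simp only [Category.assoc] at h ⊢
  rw [whisker_exchange, ← associator_naturality_left_assoc, ← comp_whiskerRight_assoc, ← hn,
    comp_whiskerRight_assoc, reassoc_of% h]

end Comodule

open Comodule

/-- If `(A, β)` represents `Nat(id, id ⊗ -)`, then `A ⊗ B` represents `Nat(F, F ⊗ -)` for the
forgetful functor `F` of `B`-comodules. A transformation in `Nat(F, F ⊗ V)` is determined by its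
values on cofree comodules `X ⊗ B`, because every coaction is a comodule morphism to a cofree
comodule, and there it amounts to a natural family `X ⊗ B ⟶ X ⊗ V`. As `B` has a dual, such a family
is given by a map `A ⊗ B ⟶ V`. -/
theorem RepresentsFirstOrder.comodule {A : C} {β : NatTensor (𝟭 C) A}
    (hβ : RepresentsFirstOrder (𝟭 C) A β) (B : C) [ComonObj B] [HasRightDual B] :
    RepresentsFirstOrder (Comodule.forget B) (A ⊗ B) (comoduleCoaction β B) := by
  intro V
  refine ⟨fun φ ψ h => hβ.hom_ext_right fun X => ?_, fun τ => ?_⟩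
  · have key : ∀ χ : A ⊗ B ⟶ V, ((comoduleCoaction β B).postcomp χ).app (cofree B X) ≫
        cofreeCounit B X ▷ V = β.app X ▷ B ≫ (α_ X A B).hom ≫ X ◁ χ := fun χ =>
      cofree_comp_cofreeCounit (β.naturality (cofreeCounit B X)) χ
    have e := congrArg (fun τ => NatTensor.app τ (cofree B X) ≫ cofreeCounit B X ▷ V) h
    exact (key φ).symm.trans (e.trans (key ψ))
  · let t : ∀ X : C, X ⊗ B ⟶ (X ⊗ B) ⊗ V := fun X => τ.app (cofree B X)
    have ht : ∀ {X Y : C} (f : X ⟶ Y), f ▷ B ≫ t Y = t X ≫ f ▷ B ▷ V := fun f =>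
      τ.naturality (cofreeMap B f)
    obtain ⟨φ, hφ⟩ := hβ.exists_hom_right (W := B) (V := V)
      (fun X => t X ≫ cofreeCounit B X ▷ V) (fun {X Y} f => by
        change f ▷ B ≫ t Y ≫ _ = (t X ≫ _) ≫ f ▷ V
        rw [reassoc_of% ht, Category.assoc, ← comp_whiskerRight, ← comp_whiskerRight,
          cofreeCounit_naturality])
    refine ⟨φ, NatTensor.ext (funext fun M => ?_)⟩
    let m : M.X ⟶ M.X ⊗ V := τ.app M
    have h : M.coact ≫ t M.X = m ≫ M.coact ▷ V := τ.naturality (toCofree M)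
    have h' : β.app M.X ▷ B ≫ (α_ M.X A B).hom ≫ M.X ◁ φ = t M.X ≫ cofreeCounit B M.X ▷ V :=
      hφ M.X
    change (M.coact ≫ β.app M.X ▷ B ≫ (α_ M.X A B).hom) ≫ M.X ◁ φ = m
    simp only [Category.assoc]
    rw [h', reassoc_of% h, ← comp_whiskerRight, coact_cofreeCounit, id_whiskerRight,
      Category.comp_id]

end Cofree

/-! ### The braided tensor product algebra and the cross coproduct -/

section Formulas

variable {C : Type u} [Category.{v} C] [MonoidalCategory C] [BraidedCategory C]
variable {A B X Y : C}

/-- Coacting with `B` and then with `A` is a coaction of the braided tensor product algebra. -/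
theorem tensorCoactBy_tensor [MonObj A] [MonObj B] (ρ : X ⟶ X ⊗ B) (b : X ⟶ X ⊗ A)
    (σ : Y ⟶ Y ⊗ B) (c : Y ⟶ Y ⊗ A) :
    tensorCoactBy (tensorμ A B A B ≫ (MonObj.mul ⊗ₘ MonObj.mul))
        (ρ ≫ b ▷ B ≫ (α_ X A B).hom) (σ ≫ c ▷ B ≫ (α_ Y A B).hom) =
      tensorCoact ρ σ ≫ tensorCoact b c ▷ B ≫ (α_ (X ⊗ Y) A B).hom := by
  simp only [tensorCoactBy, tensorCoact, whiskerLeft_comp, comp_whiskerRight, Category.assoc]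
  rw [← tensorHom_comp_tensorHom_assoc, ← tensorHom_comp_tensorHom_assoc,
    ← associator_monoidal_assoc, reassoc_of% tensorμ_outer]
  rw [whisker_exchange_assoc, whisker_exchange_assoc, associator_naturality_middle,
    MonoidalCategory.tensorHom_def' (MonObj.mul (X := A)), whiskerLeft_comp,
    associator_naturality_right_assoc]

theorem comp_tensor_counit {C : Type u} [Category.{v} C] [MonoidalCategory C] {A B X : C}
    [ComonObj A] [ComonObj B] {ρ : X ⟶ X ⊗ B} {b : X ⟶ X ⊗ A}
    (hρ : ρ ≫ X ◁ ComonObj.counit = (ρ_ X).inv) (hb : b ≫ X ◁ ComonObj.counit = (ρ_ X).inv) :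
    (ρ ≫ b ▷ B ≫ (α_ X A B).hom) ≫
      X ◁ ((ComonObj.counit ⊗ₘ ComonObj.counit) ≫ (λ_ (𝟙_ C)).hom) = (ρ_ X).inv := by
  calc
    _ = ρ ≫ (b ≫ X ◁ ComonObj.counit) ▷ B ⊗≫ X ◁ (ComonObj.counit : B ⟶ 𝟙_ C) ⊗≫ 𝟙 _ := by
      rw [MonoidalCategory.tensorHom_def]; monoidal
    _ = (ρ ≫ X ◁ ComonObj.counit) ⊗≫ 𝟙 _ := by rw [hb]; monoidal
    _ = _ := by rw [hρ]; monoidal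

/-- The composite of `ρ` and `b` is coassociative with respect to the cross coproduct, provided that
`ρ` is a morphism of `A`-comodules from `b` to the tensor product of `b` and `γ`. -/
theorem comp_crossComul [MonObj A] [ComonObj A] [ComonObj B] {ρ : X ⟶ X ⊗ B} {b : X ⟶ X ⊗ A}
    {γ : B ⟶ B ⊗ A} (hρ : ρ ≫ X ◁ ComonObj.comul = ρ ≫ ρ ▷ B ≫ (α_ X B B).hom)
    (hb : b ≫ X ◁ ComonObj.comul = b ≫ b ▷ A ≫ (α_ X A A).hom)
    (hn : ρ ≫ tensorCoact b γ = b ≫ ρ ▷ A) :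
    (ρ ≫ b ▷ B ≫ (α_ X A B).hom) ≫ X ◁ crossComul γ =
      (ρ ≫ b ▷ B ≫ (α_ X A B).hom) ≫ (ρ ≫ b ▷ B ≫ (α_ X A B).hom) ▷ (A ⊗ B) ≫
        (α_ X (A ⊗ B) (A ⊗ B)).hom := by
  -- The part of the cross coproduct after the two coproducts, without its first factor `A`.
  let K : A ⊗ (B ⊗ B) ⟶ B ⊗ (A ⊗ B) :=
    A ◁ γ ▷ B ⊗≫ (β_ A B).hom ▷ A ▷ B ⊗≫ B ◁ MonObj.mul ▷ B
  have hK : K = A ◁ γ ▷ B ⊗≫ (β_ A B).hom ▷ A ▷ B ⊗≫ B ◁ MonObj.mul ▷ B := rfl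
  calc
    _ = ρ ≫ (b ▷ B ≫ (X ⊗ A) ◁ ComonObj.comul) ⊗≫ X ◁ (ComonObj.comul : A ⟶ A ⊗ A) ▷ (B ⊗ B) ⊗≫
          X ◁ A ◁ K ⊗≫ 𝟙 _ := by
      rw [crossComul, tensorμ, MonoidalCategory.tensorHom_def', hK]; monoidal
    _ = (ρ ≫ X ◁ ComonObj.comul) ⊗≫ (b ≫ X ◁ ComonObj.comul) ▷ (B ⊗ B) ⊗≫
          X ◁ A ◁ K ⊗≫ 𝟙 _ := by
      rw [← whisker_exchange]; monoidal
    _ = ρ ≫ ρ ▷ B ⊗≫ b ▷ (B ⊗ B) ⊗≫ (b ▷ (A ⊗ (B ⊗ B)) ≫ (X ⊗ A) ◁ K) ⊗≫ 𝟙 _ := by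
      rw [hρ, hb]; monoidal
    _ = ρ ≫ (ρ ≫ tensorCoact b γ) ▷ B ⊗≫ b ▷ (B ⊗ (A ⊗ B)) ⊗≫ 𝟙 _ := by
      rw [← whisker_exchange, hK, tensorCoact, tensorμ, MonoidalCategory.tensorHom_def]; monoidal
    _ = _ := by
      rw [hn]; monoidal

end Formulas

/-! ### The two factors of a braided tensor product algebra -/

section TensorInclusions

variable {C : Type u} [Category.{v} C] [MonoidalCategory C] {A B : C}

theorem one_tensor_one_mul [MonObj A] :
    ((MonObj.one : 𝟙_ C ⟶ A) ⊗ₘ (MonObj.one : 𝟙_ C ⟶ A)) ≫ MonObj.mul =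
      (λ_ (𝟙_ C)).hom ≫ MonObj.one := by
  rw [MonoidalCategory.tensorHom_def', Category.assoc, MonObj.one_mul, leftUnitor_naturality]

variable (A B) in
/-- The inclusion of the left factor of a braided tensor product algebra. -/
def tensorInl [MonObj B] : A ⟶ A ⊗ B := (ρ_ A).inv ≫ (𝟙 A ⊗ₘ MonObj.one)

variable (A B) in
/-- The inclusion of the right factor of a braided tensor product algebra. -/
def tensorInr [MonObj A] : B ⟶ A ⊗ B := (λ_ B).inv ≫ (MonObj.one ⊗ₘ 𝟙 B)

variable [BraidedCategory C] [MonObj A] [MonObj B]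

theorem one_tensorInl : MonObj.one ≫ tensorInl A B = MonObj.one := by
  rw [tensorInl, MonObj.tensorObj.one_def, id_tensorHom, MonoidalCategory.tensorHom_def]
  simp [unitors_inv_equal]

theorem one_tensorInr : MonObj.one ≫ tensorInr A B = MonObj.one := by
  rw [tensorInr, MonObj.tensorObj.one_def, tensorHom_id, MonoidalCategory.tensorHom_def']
  simp

theorem mul_tensorInl :
    MonObj.mul ≫ tensorInl A B = (tensorInl A B ⊗ₘ tensorInl A B) ≫ MonObj.mul := by
  rw [tensorInl, MonObj.tensorObj.mul_def, ← tensorHom_comp_tensorHom_assoc,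
    tensorμ_natural_assoc, tensorHom_comp_tensorHom, id_tensorHom_id, Category.id_comp,
    one_tensor_one_mul, ← cancel_epi ((ρ_ A).hom ⊗ₘ (ρ_ A).hom), tensorHom_comp_tensorHom_assoc,
    Iso.hom_inv_id, id_tensorHom_id, Category.id_comp, rightUnitor_monoidal]
  simp only [MonoidalCategory.tensorHom_def, id_whiskerRight, Category.id_comp, Category.assoc]
  monoidal

theorem mul_tensorInr :
    MonObj.mul ≫ tensorInr A B = (tensorInr A B ⊗ₘ tensorInr A B) ≫ MonObj.mul := by
  rw [tensorInr, MonObj.tensorObj.mul_def, ← tensorHom_comp_tensorHom_assoc,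
    tensorμ_natural_assoc, tensorHom_comp_tensorHom, id_tensorHom_id, Category.id_comp,
    one_tensor_one_mul, ← cancel_epi ((λ_ B).hom ⊗ₘ (λ_ B).hom), tensorHom_comp_tensorHom_assoc,
    Iso.hom_inv_id, id_tensorHom_id, Category.id_comp, leftUnitor_monoidal]
  simp only [MonoidalCategory.tensorHom_def', whiskerLeft_id, Category.id_comp, Category.assoc]
  monoidal

theorem tensorInl_tensorInr_mul :
    (tensorInl A B ⊗ₘ tensorInr A B) ≫ MonObj.mul = 𝟙 (A ⊗ B) := by
  rw [tensorInl, tensorInr, MonObj.tensorObj.mul_def, ← tensorHom_comp_tensorHom_assoc,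
    tensorμ_natural_assoc, tensorHom_comp_tensorHom, id_tensorHom, tensorHom_id, MonObj.mul_one,
    MonObj.one_mul, tensorμ, braiding_tensorUnit_left]
  monoidal

/-- Coacting with `B` and then with `A` is the convolution product of the two coactions. -/
theorem convComp_tensorInr_tensorInl {X : C} (ρ : X ⟶ X ⊗ B) (b : X ⟶ X ⊗ A) :
    convComp (ρ ≫ X ◁ tensorInr A B) (b ≫ X ◁ tensorInl A B) =
      ρ ≫ b ▷ B ≫ (α_ X A B).hom := by
  calc
    _ = ρ ≫ (X ◁ tensorInr A B ≫ b ▷ (A ⊗ B)) ⊗≫ X ◁ tensorInl A B ▷ (A ⊗ B) ⊗≫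
          X ◁ MonObj.mul := by
      rw [convComp]; monoidal
    _ = ρ ≫ b ▷ B ≫ (α_ X A B).hom ≫ X ◁ ((tensorInl A B ⊗ₘ tensorInr A B) ≫ MonObj.mul) := by
      rw [whisker_exchange, MonoidalCategory.tensorHom_def']; monoidal
    _ = _ := by
      rw [tensorInl_tensorInr_mul]; simp

end TensorInclusions

/-! ### The prebosonisation -/

section Prebosonisation

variable {C : Type u} [Category.{v} C] [MonoidalCategory C] {A : C} {β : NatTensor (𝟭 C) A}

theorem comoduleCoaction_counit [ComonObj A] (hc : IsComonoidReconstruction (𝟭 C) A β) (B : C)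
    [ComonObj B] (M : Comodule B) :
    (comoduleCoaction β B).app M ≫
        M.X ◁ ((ComonObj.counit ⊗ₘ ComonObj.counit) ≫ (λ_ (𝟙_ C)).hom) = (ρ_ M.X).inv :=
  comp_tensor_counit M.coact_counit (hc.counit M.X)

variable [BraidedCategory C]

theorem IsMonoidReconstruction.app_tensor [MonObj A] (h : IsMonoidReconstruction (𝟭 C) A β)
    (X Y : C) : β.app (X ⊗ Y) = tensorCoact (β.app X) (β.app Y) := by
  have e : 𝟙 (X ⊗ Y) ≫ β.app (X ⊗ Y) ≫ 𝟙 (X ⊗ Y) ▷ A = tensorCoact (β.app X) (β.app Y) :=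
    h.mul X Y
  rw [← e, id_whiskerRight, Category.id_comp]
  exact (Category.comp_id _).symm

theorem IsMonoidReconstruction.app_unit [MonObj A] (h : IsMonoidReconstruction (𝟭 C) A β) :
    β.app (𝟙_ C) = unitCoact A := by
  have e : 𝟙 (𝟙_ C) ≫ β.app (𝟙_ C) ≫ 𝟙 (𝟙_ C) ▷ A = unitCoact A := h.one
  rw [← e, id_whiskerRight, Category.id_comp]
  exact (Category.comp_id _).symm

/-- Naturality of `β` with respect to the structure maps of `B` makes `B` a comodule coalgebra. -/
theorem isComoduleCoalgebra [BimonObj A] (hm : IsMonoidReconstruction (𝟭 C) A β)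
    (hc : IsComonoidReconstruction (𝟭 C) A β) (B : C) [ComonObj B] :
    IsComoduleCoalgebra A B (β.app B) where
  coact_counit := hc.counit B
  coact_comul := hc.comul B
  comul_hom := by
    rw [← hm.app_tensor]
    exact (β.naturality (ComonObj.comul : B ⟶ B ⊗ B)).symm
  counit_hom := by
    rw [← hm.app_unit]
    exact (β.naturality (ComonObj.counit : B ⟶ 𝟙_ C)).symm

section

open Functor.LaxMonoidal Functor.OplaxMonoidal

theorem comoduleCoaction_tensor [MonObj A] (hm : IsMonoidReconstruction (𝟭 C) A β) (B : C)
    [BimonObj B] (M N : Comodule B) :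
    μ (Comodule.forget B) M N ≫ (comoduleCoaction β B).app (M ⊗ N) ≫
        δ (Comodule.forget B) M N ▷ (A ⊗ B) =
      tensorCoactBy (tensorμ A B A B ≫ (MonObj.mul ⊗ₘ MonObj.mul))
        ((comoduleCoaction β B).app M) ((comoduleCoaction β B).app N) := by
  have e := tensorCoactBy_tensor M.coact (β.app M.X) N.coact (β.app N.X)
  rw [← hm.app_tensor] at e
  change 𝟙 (M.X ⊗ N.X) ≫ (tensorCoact M.coact N.coact ≫ β.app (M.X ⊗ N.X) ▷ B ≫
    (α_ (M.X ⊗ N.X) A B).hom) ≫ 𝟙 (M.X ⊗ N.X) ▷ (A ⊗ B) = _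
  rw [id_whiskerRight, Category.id_comp]
  exact (Category.comp_id _).trans e.symm

end

/-- The coaction `M ⟶ M ⊗ B` is a morphism in `C`, so naturality of `β` provides the compatibility
that `comp_crossComul` needs. -/
theorem comoduleCoaction_crossComul [MonObj A] [ComonObj A]
    (hm : IsMonoidReconstruction (𝟭 C) A β) (hc : IsComonoidReconstruction (𝟭 C) A β) (B : C)
    [ComonObj B] (M : Comodule B) :
    (comoduleCoaction β B).app M ≫ M.X ◁ crossComul (A := A) (B := B) (β.app B) =
      (comoduleCoaction β B).app M ≫ (comoduleCoaction β B).app M ▷ (A ⊗ B) ≫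
        (α_ M.X (A ⊗ B) (A ⊗ B)).hom := by
  have hn : M.coact ≫ β.app (M.X ⊗ B) = β.app M.X ≫ M.coact ▷ A := β.naturality M.coact
  rw [hm.app_tensor] at hn
  exact comp_crossComul M.coact_comul (hc.comul M.X) hn

/-- Convolution inverses for the braided tensor product algebra of two Hopf monoids: coacting with
`B` and then with `A` is the convolution product of the two coactions, and both of these are
inverted by the antipodes. The inverse is the product of the two inverses in the opposite order. -/
theorem exists_convInverse_tensor {A B X : C} [HopfObj A] [HopfObj B] {b : X ⟶ X ⊗ A}
    {ρ : X ⟶ X ⊗ B} (hb : b ≫ X ◁ ComonObj.comul = b ≫ b ▷ A ≫ (α_ X A A).hom)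
    (hb' : b ≫ X ◁ ComonObj.counit = (ρ_ X).inv)
    (hρ : ρ ≫ X ◁ ComonObj.comul = ρ ≫ ρ ▷ B ≫ (α_ X B B).hom)
    (hρ' : ρ ≫ X ◁ ComonObj.counit = (ρ_ X).inv) :
    ∃ t : X ⟶ X ⊗ (A ⊗ B),
      convComp t (ρ ≫ b ▷ B ≫ (α_ X A B).hom) = convUnit (A ⊗ B) X ∧
      convComp (ρ ≫ b ▷ B ≫ (α_ X A B).hom) t = convUnit (A ⊗ B) X := by
  rw [← convComp_tensorInr_tensorInl]
  refine ⟨convComp ((b ≫ X ◁ HopfObj.antipode) ≫ X ◁ tensorInl A B)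
    ((ρ ≫ X ◁ HopfObj.antipode) ≫ X ◁ tensorInr A B), ?_, ?_⟩
  · rw [convComp_assoc, ← convComp_assoc _ (ρ ≫ _), convComp_whiskerLeft _ mul_tensorInr,
      antipode_convComp hρ hρ', convUnit_whiskerLeft _ one_tensorInr, convUnit_convComp,
      convComp_whiskerLeft _ mul_tensorInl, antipode_convComp hb hb',
      convUnit_whiskerLeft _ one_tensorInl]
  · rw [convComp_assoc, ← convComp_assoc _ ((b ≫ _) ≫ _), convComp_whiskerLeft _ mul_tensorInl,
      convComp_antipode hb hb', convUnit_whiskerLeft _ one_tensorInl, convUnit_convComp,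
      convComp_whiskerLeft _ mul_tensorInr, convComp_antipode hρ hρ',
      convUnit_whiskerLeft _ one_tensorInr]

end Prebosonisation

end BraidedReconstruction

/-- Let `C` be a rigid braided category such that `(A, β)` represents `V ↦ Nat(id, id ⊗ V)` and its
higher order versions, and let `B` be a Hopf monoid in `C`. Then `A` has a unique structure of Hopf
monoid reconstructed from the identity functor (this is `Aut(C)`), `B` is a comodule coalgebra under
`β_B`, and `A ⊗ B` has a unique structure of Hopf monoid reconstructed from the forgetful
functor of `B`-comodules; its algebra is the braided tensor product algebra and its coalgebra is the
cross coproduct by `β_B`. -/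
theorem theorem2p2 {C : Type u} [Category.{v} C] [MonoidalCategory C] [BraidedCategory C]
    [RightRigidCategory C] (A : C) (β : NatTensor (𝟭 C) A)
    (hβ : Represents (𝟭 C) A β) (B : C) [HopfObj B] :
    (∃! _hA : HopfObj A, IsBraidedReconstruction (𝟭 C) A β) ∧
    ∀ [HopfObj A], IsBraidedReconstruction (𝟭 C) A β →
      IsComoduleCoalgebra A B (β.app B) ∧
      (∃! _hAB : HopfObj (A ⊗ B),
        IsBraidedReconstruction (Comodule.forget B)
          (A ⊗ B) (comoduleCoaction β B)) ∧
      ∀ hAB : HopfObj (A ⊗ B),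
        IsBraidedReconstruction (Comodule.forget B)
          (A ⊗ B) (comoduleCoaction β B) →
        hAB.toMonObj = MonObj.tensorObj.instTensorObj ∧
        hAB.toComonObj.comul = crossComul (A := A) (B := B) (β.app B) ∧
        hAB.toComonObj.counit = (ComonObj.counit ⊗ₘ ComonObj.counit) ≫ (λ_ (𝟙_ C)).hom := by
  refine ⟨?_, ?_⟩
  · obtain ⟨h, H⟩ := hβ.exists_hopfObj
    exact ⟨h, H, fun h' H' => IsBraidedReconstruction.unique H' H⟩
  intro hA H
  have hm := H.isMonoidReconstruction
  have hc := H.isComonoidReconstruction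
  let _ : HasRightDual B := RightRigidCategory.rightDual B
  have hγ : Represents (Comodule.forget B) (A ⊗ B) (comoduleCoaction β B) :=
    Represents.of_firstOrder (hβ.firstOrder.comodule B)
  refine ⟨isComoduleCoalgebra hm hc B, ?_, fun hAB K => ⟨?_, ?_, ?_⟩⟩
  · obtain ⟨b, hbm, hbc⟩ := hγ.exists_bimonObj
    have hmul : b.toMonObj = MonObj.tensorObj.instTensorObj :=
      MonObj.ext _ _ (hbm.mul_eq hγ (comoduleCoaction_tensor hm B))
    choose t ht using fun M : Comodule B => exists_convInverse_tensor (hc.comul M.X)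
      (hc.counit M.X) M.coact_comul M.coact_counit
    obtain ⟨h, H'⟩ := exists_hopfObj_of_convInverse hγ hbm hbc t
      (fun M => by rw [hmul]; exact (ht M).1) (fun M => by rw [hmul]; exact (ht M).2)
    exact ⟨h, H', fun h' H'' => IsBraidedReconstruction.unique H'' H'⟩
  · exact MonObj.ext _ _
      (K.isMonoidReconstruction.mul_eq hγ (comoduleCoaction_tensor hm B))
  · exact K.isComonoidReconstruction.comul_eq hγ (comoduleCoaction_crossComul hm hc B)
  · exact K.isComonoidReconstruction.counit_eq hγ (comoduleCoaction_counit hc B)
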